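/- **Theorem (Universal uniform test).** Let $X$ be a computable metric space: a complete metric space $(X,d)$ with a dense sequence $(s_i)_{i\in\mathbb N}$ of ideal points such that the reals $d(s_i,s_j)$ are computable uniformly in $(i,j)$. Then there is a universal uniform randomness test on $X$, that is, a uniform randomness test $T_u$ such that for every uniform randomness test $T$ there is a real constant $c_T>0$ with $$T_u^\mu(x)\ \ge\ c_T\,T^\mu(x)\qquad\text{for all Borel probability measures }\mu\text{ on }X\text{ and all }x\in X .$$ Here $\mathcal M(X)$ is the set of Borel probability measures on $X$ with the Prokhorov metric $\rho$. Its ideal points $\mu_0,\mu_1,\dots$ are the probability measures concentrated on finitely many ideal points of $X$ with rational weights, numbered in a standard effective way. A name of $\mu\in\mathcal M(X)$ is a sequence $(n_k)_k$ of integers with $\rho(\mu_{n_k},\mu_{n_{k+1}})<2^{-k}$ for all $k$ and $\mu_{n_k}\to\mu$. A step function on $X$ takes a nonnegative rational value $q$ on a ball $B(s_i,r)$ with rational radius $r>0$ and the value $0$ elsewhere; step functions are numbered in a standard effective way. $\mathcal C(X,[0,\infty])$ is the set of pointwise suprema of families of step functions (these are the lower semicontinuous functions $X\to[0,\infty]$),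 and a description of $f\in\mathcal C(X,[0,\infty])$ is a finite (possibly empty) or infinite sequence of codes of step functions whose pointwise supremum is $f$. A function $T:\mathcal M(X)\to\mathcal C(X,[0,\infty])$, $\mu\mapsto T^\mu$, is constructive if some recursive operator on integer sequences maps every name of every $\mu\in\mathcal M(X)$ to a description of $T^\mu$; here a recursive operator is given by a recursive function on finite sequences of integers that is monotone for the prefix order, its value on an infinite sequence being the limit of its values on the finite prefixes. A uniform randomness test is a constructive function $T:\mathcal M(X)\to\mathcal C(X,[0,\infty])$ with $\int T^\mu\,d\mu\le 1$ for every $\mu\in\mathcal M(X)$. -/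

import Mathlib

open MeasureTheory Filter Topology
open scoped ENNReal NNReal

noncomputable section

namespace CompMetric

/-- Standard numbering of the rationals: the code `⟨⟨a, b⟩, c⟩` stands for `(a - b) / (c + 1)`. -/
def ratNum (n : ℕ) : ℝ :=
  ((n.unpair.1.unpair.1 : ℝ) - (n.unpair.1.unpair.2 : ℝ)) / ((n.unpair.2 : ℝ) + 1)

/-- Standard numbering of the positive rationals: `⟨a, b⟩` stands for `(a + 1) / (b + 1)`. -/
def posRatNum (n : ℕ) : ℝ := ((n.unpair.1 : ℝ) + 1) / ((n.unpair.2 : ℝ) + 1)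

/-- Standard numbering of the nonnegative rationals: `⟨a, b⟩` stands for `a / (b + 1)`. -/
def nnRatNum (n : ℕ) : ℝ≥0 := (n.unpair.1 : ℝ≥0) / ((n.unpair.2 : ℝ≥0) + 1)

/-- The Cauchy representation attached to a sequence `s` of ideal points: `σ` is a name of `x` if
`s (σ 0), s (σ 1), …` is a fast Cauchy sequence that converges to `x`. -/
def IsCauchyName {X : Type*} [PseudoMetricSpace X] (s : ℕ → X) (σ : ℕ → ℕ) (x : X) : Prop :=
  (∀ n, dist (s (σ n)) (s (σ (n + 1))) < (1 / 2 : ℝ) ^ n) ∧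
    Tendsto (fun n => s (σ n)) atTop (𝓝 x)

/-- A computable metric space structure on a complete metric space: a dense sequence of ideal
points whose mutual distances are computable reals, uniformly in the pair of indices. -/
structure ComputableMetricSpace (X : Type*) [MetricSpace X] [CompleteSpace X] where
  ideal : ℕ → X
  dense : DenseRange ideal
  dist_computable : ∃ f : ℕ × ℕ × ℕ → ℕ, Computable f ∧
    ∀ i j, IsCauchyName ratNum (fun n => f (i, j, n)) (dist (ideal i) (ideal j))

/-- An enumerative lattice structure on a complete lattice: a numbered family such that every
element is the supremum of a subfamily. -/
structure EnumerativeLattice (Y : Type*) [CompleteLattice Y] where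
  elem : ℕ → Y
  exists_eq_iSup : ∀ y, ∃ E : Set ℕ, y = ⨆ n ∈ E, elem n

/-- The canonical representation of an enumerative lattice: `E` is the set of the codes listed by
the (possibly empty) description, and the element described is the supremum. -/
def EnumerativeLattice.Describes {Y : Type*} [CompleteLattice Y] (L : EnumerativeLattice Y)
    (E : Set ℕ) (y : Y) : Prop :=
  y = ⨆ n ∈ E, L.elem n

/-- A recursive operator on sequences of integers, given by its action on finite prefixes:
a recursive function on finite sequences which is monotone for the prefix order. -/
structure IsRecursiveOperator (F : List ℕ → List ℕ) : Prop where
  computable : Computable F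
  monotone : ∀ u v : List ℕ, u <+: v → F u <+: F v

/-- The set of terms of the finite or infinite sequence which is the limit of the values of `F`
on the finite prefixes of `σ`. -/
def operatorOutput (F : List ℕ → List ℕ) (σ : ℕ → ℕ) : Set ℕ :=
  {m | ∃ k, m ∈ F ((List.range k).map σ)}

/-- A function from a metric space, represented through its ideal points `s`, to an enumerative
lattice is constructive if a recursive operator maps every name of every `x` to a description
of `f x`. -/
def IsConstructive {X Y : Type*} [PseudoMetricSpace X] [CompleteLattice Y] (s : ℕ → X)
    (L : EnumerativeLattice Y) (f : X → Y) : Prop :=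
  ∃ F : List ℕ → List ℕ, IsRecursiveOperator F ∧
    ∀ x σ, IsCauchyName s σ x → L.Describes (operatorOutput F σ) (f x)

section StepFunctions

variable {X Y : Type*} [MetricSpace X] [CompleteSpace X] [CompleteLattice Y]

/-- The `n`-th ideal ball, `n = ⟨i, j⟩`: centre `s_i`, radius the `j`-th positive rational. -/
def ComputableMetricSpace.idealBall (S : ComputableMetricSpace X) (n : ℕ) : Set X :=
  Metric.ball (S.ideal n.unpair.1) (posRatNum n.unpair.2)

open Classical in
/-- The step function with code `⟨i, j⟩`: value `p_j` on the `i`-th ideal ball, `⊥` elsewhere. -/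
def stepFun (S : ComputableMetricSpace X) (L : EnumerativeLattice Y) (n : ℕ) : X → Y :=
  fun x => if x ∈ S.idealBall n.unpair.1 then L.elem n.unpair.2 else ⊥

/-- The space `𝒞(X, Y)`: all pointwise suprema of families of step functions. -/
def LowerFun (S : ComputableMetricSpace X) (L : EnumerativeLattice Y) : Type _ :=
  {f : X → Y // ∃ E : Set ℕ, f = ⨆ n ∈ E, stepFun S L n}

namespace LowerFun

variable {S : ComputableMetricSpace X} {L : EnumerativeLattice Y}

instance : CoeFun (LowerFun S L) (fun _ => X → Y) := ⟨Subtype.val⟩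

instance : PartialOrder (LowerFun S L) := Subtype.partialOrder _

theorem exists_iSup_eq (A : Set (LowerFun S L)) :
    ∃ E : Set ℕ, (⨆ f ∈ A, f.1 : X → Y) = ⨆ n ∈ E, stepFun S L n := by
  choose E hE using fun f : LowerFun S L => f.2
  refine ⟨⋃ f ∈ A, E f, le_antisymm ?_ ?_⟩
  · refine iSup₂_le fun f hf => ?_
    rw [hE f]
    exact iSup₂_le fun n hn => le_iSup₂_of_le n (Set.mem_biUnion hf hn) le_rfl
  · refine iSup₂_le fun n hn => ?_
    obtain ⟨f, hf, hn⟩ := Set.mem_iUnion₂.1 hn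
    refine le_iSup₂_of_le f hf ?_
    rw [hE f]
    exact le_iSup₂_of_le n hn le_rfl

instance : SupSet (LowerFun S L) := ⟨fun A => ⟨⨆ f ∈ A, f.1, exists_iSup_eq A⟩⟩

instance : CompleteLattice (LowerFun S L) :=
  completeLatticeOfSup _ fun A =>
    ⟨fun f hf => show f.1 ≤ ⨆ g ∈ A, g.1 from le_iSup₂_of_le f hf le_rfl,
      fun g hg => show (⨆ f ∈ A, f.1) ≤ g.1 from iSup₂_le fun _ hf => hg hf⟩

theorem coe_iSup {ι : Sort*} (g : ι → LowerFun S L) : (⨆ i, g i).1 = ⨆ i, (g i).1 := by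
  show (⨆ f ∈ Set.range g, f.1) = _
  exact iSup_range

/-- The step function with code `n` as an element of `𝒞(X, Y)`. -/
def step (S : ComputableMetricSpace X) (L : EnumerativeLattice Y) (n : ℕ) : LowerFun S L :=
  ⟨stepFun S L n, {n}, by simp⟩

/-- The enumerative lattice structure of `𝒞(X, Y)` given by the step functions. -/
def enumerativeLattice (S : ComputableMetricSpace X) (L : EnumerativeLattice Y) :
    EnumerativeLattice (LowerFun S L) where
  elem := step S L
  exists_eq_iSup f := by
    obtain ⟨E, hE⟩ := f.2
    refine ⟨E, Subtype.ext ?_⟩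
    rw [hE, coe_iSup]
    simp only [coe_iSup]
    rfl

end LowerFun

end StepFunctions

theorem exists_nnRatNum (q : ℚ≥0) : ∃ n, nnRatNum n = (q : ℝ≥0) := by
  refine ⟨Nat.pair q.num (q.den - 1), ?_⟩
  have h : 1 ≤ q.den := q.den_pos
  have h2 : ((q.den - 1 : ℕ) : ℝ≥0) + 1 = (q.den : ℝ≥0) := by
    exact_mod_cast congrArg (Nat.cast (R := ℝ≥0)) (Nat.sub_add_cancel h)
  simp only [nnRatNum, Nat.unpair_pair, h2]
  exact (NNRat.cast_def q).symm

/-- `[0, ∞]` with the nonnegative rationals as an enumerative lattice. -/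
def ennrealLattice : EnumerativeLattice ℝ≥0∞ where
  elem n := (nnRatNum n : ℝ≥0∞)
  exists_eq_iSup y := by
    refine ⟨{n | (nnRatNum n : ℝ≥0∞) ≤ y}, le_antisymm ?_ (iSup₂_le fun n hn => hn)⟩
    refine le_of_forall_lt fun a ha => ?_
    obtain ⟨q, hq, haq, hqy⟩ := ENNReal.lt_iff_exists_rat_btwn.1 ha
    obtain ⟨n, hn⟩ := exists_nnRatNum ⟨q, hq⟩
    have h : (Real.toNNReal (q : ℝ)) = nnRatNum n := by
      rw [hn]
      apply NNReal.coe_injective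
      rw [Real.coe_toNNReal _ (by exact_mod_cast hq)]
      rfl
    rw [h] at haq hqy
    exact haq.trans_le (le_iSup₂_of_le n hqy.le le_rfl)

section WeightedSum

variable {X : Type*} [MeasurableSpace X]

/-- The measure `∑ (w + 1) δ_{s_i}` over the pairs `(i, w)` of a list. -/
def weightedSum (s : ℕ → X) : List (ℕ × ℕ) → Measure X
  | [] => 0
  | a :: l => ((a.2 : ℝ≥0∞) + 1) • Measure.dirac (s a.1) + weightedSum s l

/-- The nonempty list of pairs (index of an ideal point, weight) with code `n`. -/
def weightList (n : ℕ) : List (ℕ × ℕ) :=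
  n.unpair.1.unpair :: Denumerable.ofNat (List (ℕ × ℕ)) n.unpair.2

theorem weightedSum_univ_ne_top (s : ℕ → X) (l : List (ℕ × ℕ)) :
    weightedSum s l Set.univ ≠ ⊤ := by
  induction l with
  | nil => simp [weightedSum]
  | cons a l ih => simp [weightedSum, ih]

theorem weightedSum_univ_ne_zero (s : ℕ → X) (n : ℕ) :
    weightedSum s (weightList n) Set.univ ≠ 0 := by
  simp [weightedSum, weightList]

end WeightedSum

section Measures

variable {X : Type*} [MetricSpace X] [CompleteSpace X] [MeasurableSpace X] [BorelSpace X]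

/-- The numbering of the ideal measures, the probability measures which are concentrated on
finitely many ideal points and give them rational weights. The code `n` lists points `s_i` with
positive integer weights `w + 1`, which are divided by their sum. -/
def idealMeasure (S : ComputableMetricSpace X) (n : ℕ) :
    LevyProkhorov (ProbabilityMeasure X) :=
  LevyProkhorov.ofMeasure
    ⟨(weightedSum S.ideal (weightList n) Set.univ)⁻¹ • weightedSum S.ideal (weightList n),
      ⟨by
        rw [Measure.smul_apply, smul_eq_mul]
        exact ENNReal.inv_mul_cancel (weightedSum_univ_ne_zero _ _)
          (weightedSum_univ_ne_top _ _)⟩⟩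

/-- A uniform randomness test: a constructive function `T` from the probability measures, with the
Prokhorov metric and the ideal measures, to `𝒞(X, [0, ∞])` such that `∫ T μ dμ ≤ 1` for all `μ`. -/
structure IsUniformTest (S : ComputableMetricSpace X)
    (T : LevyProkhorov (ProbabilityMeasure X) → LowerFun S ennrealLattice) : Prop where
  constructive :
    IsConstructive (idealMeasure S) (LowerFun.enumerativeLattice S ennrealLattice) T
  lintegral_le_one : ∀ μ : LevyProkhorov (ProbabilityMeasure X),
    ∫⁻ x, T μ x ∂(μ.toMeasure : Measure X) ≤ 1

end Measures

end CompMetric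

end

/-!
A recursive operator is a partial recursive function on codes of finite sequences, so the functions
that list step functions along names of measures have numbers `c`. Whenever the `c`-th one lists a
step function on a finite prefix of a name, this yields an atom: a step function together with a
ball of measures, all of which have names that start with that prefix. The test with number `c` is,
up to rounding, the supremum of its atoms, but for arbitrary `c` this supremum may have a large
integral. Hence the atoms are trimmed: at `μ`, the `i`-th atom is kept only if the supremum of the
first `i` atoms, on closed balls, has `μ`-integral less than `2`. As the balls are closed, this
integral is upper semicontinuous in `μ`, with an explicit modulus when the balls are slightly
enlarged, and it is computable enough at ideal measures for the condition to be semidecidable from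
a name of `μ`. Trimming leaves the atoms of genuine tests untouched, and the supremum of the
trimmed atoms over all `c`, with weights `2 ^ (-(c + 3))`, plus a constant that pays for the
rounding, is the universal test.
-/

attribute [fun_prop] Primrec
attribute [fun_prop] Primrec.id Primrec.const Primrec.comp Primrec.pair Primrec.fst Primrec.snd
attribute [fun_prop] Primrec.unpair Primrec.list_length Primrec.list_range Primrec.ofNat
attribute [fun_prop] Primrec.encode

namespace CompMetric

section Primrec

variable {α β : Type*} [Primcodable α] [Primcodable β]

@[fun_prop]
theorem primrec_add {f g : α → ℕ} (hf : Primrec f) (hg : Primrec g) :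
    Primrec fun a => f a + g a :=
  Primrec.nat_add.comp hf hg

@[fun_prop]
theorem primrec_sub {f g : α → ℕ} (hf : Primrec f) (hg : Primrec g) :
    Primrec fun a => f a - g a :=
  Primrec.nat_sub.comp hf hg

@[fun_prop]
theorem primrec_mul {f g : α → ℕ} (hf : Primrec f) (hg : Primrec g) :
    Primrec fun a => f a * g a :=
  Primrec.nat_mul.comp hf hg

@[fun_prop]
theorem primrec_pow {f g : α → ℕ} (hf : Primrec f) (hg : Primrec g) :
    Primrec fun a => f a ^ g a :=
  (Primrec₂.unpaired'.1 Nat.Primrec.pow).comp hf hg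

@[fun_prop]
theorem primrec_natPair {f g : α → ℕ} (hf : Primrec f) (hg : Primrec g) :
    Primrec fun a => Nat.pair (f a) (g a) :=
  Primrec₂.natPair.comp hf hg

@[fun_prop]
theorem primrec_cons {f : α → β} {g : α → List β} (hf : Primrec f) (hg : Primrec g) :
    Primrec fun a => f a :: g a :=
  Primrec.list_cons.comp hf hg

@[fun_prop]
theorem primrec_append {f g : α → List β} (hf : Primrec f) (hg : Primrec g) :
    Primrec fun a => f a ++ g a :=
  Primrec.list_append.comp hf hg

@[fun_prop]
theorem primrec_take {f : α → List β} {g : α → ℕ} (hf : Primrec f) (hg : Primrec g) :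
    Primrec fun a => (f a).take (g a) :=
  Primrec.list_take.comp hg hf

@[fun_prop]
theorem primrec_getD {f : α → List β} {g : α → ℕ} {d : β} (hf : Primrec f) (hg : Primrec g) :
    Primrec fun a => (f a).getD (g a) d :=
  (Primrec.list_getD d).comp hf hg

@[fun_prop]
theorem primrec_sublists' {f : α → List β} (hf : Primrec f) :
    Primrec fun a => (f a).sublists' := by
  have h : Primrec₂ fun (_ : α) (x : β × List (List β)) => x.2 ++ x.2.map (List.cons x.1) :=
    Primrec.list_append.comp (Primrec.snd.comp Primrec.snd)
      (Primrec.list_map (Primrec.snd.comp Primrec.snd)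
        (Primrec.list_cons.comp (Primrec.fst.comp (Primrec.snd.comp Primrec.fst)) Primrec.snd))
  refine (Primrec.list_foldr hf (Primrec.const [[]]) h).of_eq fun a => ?_
  induction f a with
  | nil => rfl
  | cons b l ih => simp only [List.foldr_cons, ih, List.sublists'_cons]

end Primrec

section REPred

variable {α β : Type*} [Primcodable α] [Primcodable β] {p q : α → Prop}

theorem rePred_iff_exists_primrecPred :
    REPred p ↔ ∃ r : α × ℕ → Prop, PrimrecPred r ∧ ∀ a, p a ↔ ∃ n, r (a, n) := by
  constructor
  · intro hp
    obtain ⟨c, hc⟩ := Nat.Partrec.Code.exists_code.1 hp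
    refine ⟨fun x => (c.evaln x.2 (Encodable.encode x.1)).isSome = true, ?_, fun a => ?_⟩
    · exact Primrec.eq.comp (Primrec.option_isSome.comp (Nat.Partrec.Code.primrec_evaln.comp
        ((Primrec.snd.pair (Primrec.const c)).pair (by fun_prop)))) (Primrec.const true)
    · have h : p a ↔ (c.eval (Encodable.encode a)).Dom := by simp [hc, Part.assert]
      simp only [h, Part.dom_iff_mem, Nat.Partrec.Code.evaln_complete, Option.isSome_iff_exists,
        Option.mem_def]
      exact exists_comm
  · rintro ⟨r, ⟨_, hr⟩, h⟩
    have hfind : Partrec fun a => Nat.rfind fun n => Part.some (decide (r (a, n))) :=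
      Partrec.rfind (p := fun a n => Part.some (decide (r (a, n)))) hr.to_comp.partrec
    refine hfind.dom_re.of_eq fun a => ?_
    rw [h]
    exact Nat.rfind_dom.trans (by simp)

theorem rePred_of_primrecPred (hp : PrimrecPred p) : REPred p :=
  hp.computablePred.to_re

theorem rePred_lt {f g : α → ℕ} (hf : Primrec f) (hg : Primrec g) : REPred fun a => f a < g a :=
  rePred_of_primrecPred (Primrec.nat_lt.comp hf hg)

theorem rePred_le {f g : α → ℕ} (hf : Primrec f) (hg : Primrec g) : REPred fun a => f a ≤ g a :=
  rePred_of_primrecPred (Primrec.nat_le.comp hf hg)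

theorem rePred_eq {f g : α → β} (hf : Primrec f) (hg : Primrec g) : REPred fun a => f a = g a :=
  rePred_of_primrecPred (Primrec.eq.comp hf hg)

theorem rePred_comp_computable {p : β → Prop} {f : α → β} (hp : REPred p) (hf : Computable f) :
    REPred fun a => p (f a) :=
  Partrec.comp hp hf

theorem rePred_comp {p : β → Prop} {f : α → β} (hp : REPred p) (hf : Primrec f) :
    REPred fun a => p (f a) :=
  rePred_comp_computable hp hf.to_comp

theorem rePred_or (hp : REPred p) (hq : REPred q) : REPred fun a => p a ∨ q a := by
  obtain ⟨r, hr, hpr⟩ := rePred_iff_exists_primrecPred.1 hp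
  obtain ⟨s, hs, hqs⟩ := rePred_iff_exists_primrecPred.1 hq
  refine rePred_iff_exists_primrecPred.2 ⟨fun x => r x ∨ s x, hr.or hs, fun a => ?_⟩
  rw [hpr, hqs, exists_or]

theorem rePred_and (hp : REPred p) (hq : REPred q) : REPred fun a => p a ∧ q a :=
  (Partrec.bind hp (Partrec.comp hq Computable.fst).to₂).of_eq fun a => by
    ext; simp [Part.mem_assert_iff]

theorem rePred_exists {p : α → β → Prop} (hp : REPred fun x : α × β => p x.1 x.2) :
    REPred fun a => ∃ b, p a b := by
  obtain ⟨r, hr, h⟩ := rePred_iff_exists_primrecPred.1 hp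
  refine rePred_iff_exists_primrecPred.2
    ⟨fun x => ∃ y ∈ (Encodable.decode x.2 : Option (β × ℕ)).toList, r ((x.1, y.1), y.2),
      ?_, fun a => ?_⟩
  · have hr' : PrimrecRel fun (y : β × ℕ) (x : α × ℕ) => r ((x.1, y.1), y.2) :=
      hr.comp (f := fun z : (β × ℕ) × α × ℕ => ((z.2.1, z.1.1), z.1.2)) (by fun_prop)
    exact hr'.exists_mem_list.comp
      (Primrec.optionToList.comp (Primrec.decode.comp Primrec.snd)) Primrec.id
  · simp only [fun b => h (a, b), Option.mem_toList]
    constructor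
    · rintro ⟨b, n, hn⟩
      exact ⟨Encodable.encode (b, n), (b, n), Encodable.encodek _, hn⟩
    · rintro ⟨-, ⟨b, n⟩, -, hn⟩
      exact ⟨b, n, hn⟩

theorem rePred_forall_mem {p : α → β → Prop} {l : α → List β}
    (hp : REPred fun x : α × β => p x.1 x.2) (hl : Primrec l) :
    REPred fun a => ∀ b ∈ l a, p a b := by
  obtain ⟨r, hr, h⟩ := rePred_iff_exists_primrecPred.1 hp
  refine rePred_iff_exists_primrecPred.2
    ⟨fun x => ∀ b ∈ l x.1, ∃ n ∈ List.range x.2, r ((x.1, b), n), ?_, fun a => ?_⟩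
  · have hr₁ : PrimrecRel fun (n : ℕ) (y : β × α × ℕ) => r ((y.2.1, y.1), n) :=
      hr.comp (f := fun z : ℕ × β × α × ℕ => ((z.2.2.1, z.2.1), z.1)) (by fun_prop)
    have hr₂ : PrimrecRel fun (b : β) (x : α × ℕ) => ∃ n ∈ List.range x.2, r ((x.1, b), n) :=
      hr₁.exists_mem_list.comp (f := fun y : β × α × ℕ => List.range y.2.2) (by fun_prop)
        Primrec.id
    exact hr₂.forall_mem_list.comp (hl.comp Primrec.fst) Primrec.id
  · simp only [List.mem_range, fun b => h (a, b)]
    constructor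
    · intro H
      classical
      choose! n hn using H
      obtain ⟨N, hN⟩ := ((l a).toFinset.image n).bddAbove
      refine ⟨N + 1, fun b hb => ⟨n b, Nat.lt_succ_of_le (hN ?_), hn b hb⟩⟩
      simpa using ⟨b, hb, rfl⟩
    · rintro ⟨N, hN⟩ b hb
      obtain ⟨n, -, hn⟩ := hN b hb
      exact ⟨n, hn⟩

theorem rePred_forall_lt {p : α → ℕ → Prop} {f : α → ℕ} (hp : REPred fun x : α × ℕ => p x.1 x.2)
    (hf : Primrec f) : REPred fun a => ∀ n < f a, p a n :=
  (rePred_forall_mem (l := fun a => List.range (f a)) hp (by fun_prop)).of_eq fun a => by simp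

theorem rePred_exists_mem {p : α → β → Prop} {l : α → List β}
    (hp : REPred fun x : α × β => p x.1 x.2) (hl : Primrec l) :
    REPred fun a => ∃ b ∈ l a, p a b := by
  have h_mem : REPred fun x : α × β => x.2 ∈ l x.1 :=
    (rePred_of_primrecPred (Primrec.eq.exists_mem_list.comp (hl.comp Primrec.fst)
      Primrec.snd)).of_eq fun x => by simp
  exact rePred_exists (rePred_and h_mem hp)

theorem rePred_mem_of_partrec {f : α →. β} (hf : Partrec f) :
    REPred fun x : α × β => x.2 ∈ f x.1 := by
  have h_eq : Partrec₂ fun (x : α × β) (b : β) => Part.assert (x.2 = b) fun _ => Part.some () :=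
    rePred_eq (Primrec.snd.comp Primrec.fst) Primrec.snd
  refine ((hf.comp Computable.fst).bind h_eq).dom_re.of_eq fun x => ?_
  simp [Part.dom_iff_mem, Part.mem_assert_iff]

end REPred

section Operators

/-- Concatenating the values of `G` on all prefixes of the input makes it monotone. -/
theorem isRecursiveOperator_flatMap_take {G : List ℕ → List ℕ} (hG : Primrec G) :
    IsRecursiveOperator fun u => (List.range (u.length + 1)).flatMap fun k => G (u.take k) where
  computable := by
    have h_take : Primrec₂ fun (u : List ℕ) (k : ℕ) => G (u.take k) :=
      hG.comp (Primrec.list_take.comp Primrec.snd Primrec.fst)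
    exact (Primrec.list_flatMap (by fun_prop) h_take).to_comp
  monotone := by
    rintro u v ⟨w, rfl⟩
    have h_take : ∀ k ∈ List.range (u.length + 1), G ((u ++ w).take k) = G (u.take k) := by
      intro k hk
      rw [List.take_append_of_le_length (Nat.lt_succ_iff.1 (List.mem_range.1 hk))]
    rw [List.length_append, Nat.add_right_comm, List.range_add (n := u.length + 1),
      List.flatMap_append, List.flatMap_congr h_take]
    exact List.prefix_append _ _

theorem operatorOutput_flatMap_take (G : List ℕ → List ℕ) (σ : ℕ → ℕ) :
    operatorOutput (fun u => (List.range (u.length + 1)).flatMap fun k => G (u.take k)) σ =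
      {m | ∃ k, m ∈ G ((List.range k).map σ)} := by
  ext m
  simp only [operatorOutput, Set.mem_ofPred_eq, List.mem_flatMap, List.mem_range,
    List.length_map, List.length_range, ← List.map_take, List.take_range]
  constructor
  · rintro ⟨k, j, -, hm⟩
    exact ⟨_, hm⟩
  · rintro ⟨k, hm⟩
    exact ⟨k, k, Nat.lt_succ_self k, by rwa [min_self]⟩

theorem exists_isRecursiveOperator {P : List ℕ × ℕ → Prop} (hP : REPred P) :
    ∃ F, IsRecursiveOperator F ∧
      ∀ σ, operatorOutput F σ = {m | ∃ k, P ((List.range k).map σ, m)} := by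
  classical
  obtain ⟨r, hr, h⟩ := rePred_iff_exists_primrecPred.1 hP
  -- The length of a prefix codes which shorter prefix `j`, value `m` and witness `i` to test.
  let R : List ℕ → Prop := fun u =>
    r ((u.take u.length.unpair.1, u.length.unpair.2.unpair.1), u.length.unpair.2.unpair.2)
  let G : List ℕ → List ℕ := fun u => if R u then [u.length.unpair.2.unpair.1] else []
  have hG : Primrec G := Primrec.ite (hr.comp (by fun_prop)) (by fun_prop) (Primrec.const [])
  refine ⟨_, isRecursiveOperator_flatMap_take hG, fun σ => ?_⟩
  rw [operatorOutput_flatMap_take]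
  ext m
  simp only [Set.mem_ofPred_eq, G, R, List.mem_ite_nil_right, List.mem_singleton,
    List.length_map, List.length_range, ← List.map_take, List.take_range, h]
  constructor
  · rintro ⟨k, hr, rfl⟩
    exact ⟨_, _, hr⟩
  · rintro ⟨j, i, hr⟩
    refine ⟨Nat.pair j (Nat.pair m i), ?_⟩
    simp only [Nat.unpair_pair, min_eq_left (Nat.left_le_pair _ _)]
    exact ⟨hr, trivial⟩

end Operators

theorem tendsto_two_mul_half_pow : Tendsto (fun n : ℕ => 2 * (1 / 2 : ℝ) ^ n) atTop (𝓝 0) := by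
  simpa using (tendsto_pow_atTop_nhds_zero_of_lt_one (r := (1 / 2 : ℝ)) (by norm_num)
    (by norm_num)).const_mul 2

theorem IsCauchyName.dist_lt {X : Type*} [PseudoMetricSpace X] {s : ℕ → X} {σ : ℕ → ℕ} {x : X}
    (h : IsCauchyName s σ x) (n : ℕ) : dist (s (σ n)) x < 2 * (1 / 2 : ℝ) ^ n := by
  have h_tail := dist_le_of_le_geometric_of_tendsto (1 / 2 : ℝ) 1 (by norm_num)
    (fun k => by simpa using (h.1 k).le) h.2 (n + 1)
  have h_step := h.1 n
  have h_tri := dist_triangle (s (σ n)) (s (σ (n + 1))) x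
  rw [pow_succ] at h_tail
  norm_num at h_tail h_step ⊢
  linarith

section Semicomputable

variable {α β : Type*} [Primcodable α] [Primcodable β] {f : α → ℝ}

/-- The nonnegative rationals above the values of `f` can be enumerated; used for functions
`f ≥ 0` only. -/
def IsUpperSemicomputable (f : α → ℝ) : Prop :=
  REPred fun x : α × ℕ × ℕ => f x.1 < x.2.1 / (x.2.2 + 1)

/-- The nonnegative rationals below the values of `f` can be enumerated; used for functions
`f ≥ 0` only. -/
def IsLowerSemicomputable (f : α → ℝ) : Prop :=
  REPred fun x : α × ℕ × ℕ => (x.2.1 / (x.2.2 + 1) : ℝ) < f x.1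

theorem IsUpperSemicomputable.rePred_lt_div (hf : IsUpperSemicomputable f) {g : β → α}
    {num den : β → ℕ} (hg : Primrec g) (h_num : Primrec num) (h_den : Primrec den)
    (h_pos : ∀ b, 0 < den b) : REPred fun b => f (g b) < num b / den b := by
  have h := rePred_comp (f := fun b => (g b, num b, den b - 1)) hf (by fun_prop)
  refine h.of_eq fun b => ?_
  rw [Nat.cast_pred (h_pos b), sub_add_cancel]

theorem IsLowerSemicomputable.rePred_div_lt (hf : IsLowerSemicomputable f) {g : β → α}
    {num den : β → ℕ} (hg : Primrec g) (h_num : Primrec num) (h_den : Primrec den)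
    (h_pos : ∀ b, 0 < den b) : REPred fun b => (num b / den b : ℝ) < f (g b) := by
  have h := rePred_comp (f := fun b => (g b, num b, den b - 1)) hf (by fun_prop)
  refine h.of_eq fun b => ?_
  rw [Nat.cast_pred (h_pos b), sub_add_cancel]

theorem exists_nat_div_btwn {r r' : ℝ} (hr : 0 ≤ r) (h : r < r') :
    ∃ m n : ℕ, r < m / (n + 1) ∧ (m / (n + 1) : ℝ) < r' := by
  obtain ⟨q, hrq, hqr⟩ := exists_rat_btwn h
  have hq : 0 ≤ q := by exact_mod_cast hr.trans hrq.le
  obtain ⟨c, hc⟩ := exists_nnRatNum ⟨q, hq⟩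
  have h_eq : (c.unpair.1 / (c.unpair.2 + 1) : ℝ) = q := by
    exact congrArg ((↑) : ℝ≥0 → ℝ) hc
  exact ⟨c.unpair.1, c.unpair.2, h_eq ▸ hrq, h_eq ▸ hqr⟩

theorem nat_div_lt_nat_div_iff (a b c d : ℕ) :
    (a / (b + 1) : ℝ) < c / (d + 1) ↔ a * (d + 1) < c * (b + 1) := by
  rw [div_lt_div_iff₀ (by positivity) (by positivity)]
  exact_mod_cast Iff.rfl

theorem isUpperSemicomputable_of_approx (hf : ∀ a, 0 ≤ f a) {Q : α × ℕ × ℕ → Prop}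
    (hQ : REPred Q) (h_of_lt : ∀ a (m n : ℕ), f a < m / (n + 1) → Q (a, m, n))
    (h_le : ∀ a (m n : ℕ), Q (a, m, n) → f a ≤ m / (n + 1)) : IsUpperSemicomputable f := by
  have h : REPred fun x : α × ℕ × ℕ => ∃ z : ℕ × ℕ,
      z.1 * (x.2.2 + 1) < x.2.1 * (z.2 + 1) ∧ Q (x.1, z) :=
    rePred_exists (rePred_and (rePred_lt (by fun_prop) (by fun_prop))
      (rePred_comp hQ (by fun_prop)))
  refine h.of_eq fun ⟨a, m, n⟩ => ⟨?_, fun hlt => ?_⟩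
  · rintro ⟨z, hz, hQz⟩
    exact (h_le _ _ _ hQz).trans_lt ((nat_div_lt_nat_div_iff _ _ _ _).2 hz)
  · obtain ⟨m', n', hlt', hlt''⟩ := exists_nat_div_btwn (hf a) hlt
    exact ⟨(m', n'), (nat_div_lt_nat_div_iff _ _ _ _).1 hlt'', h_of_lt _ _ _ hlt'⟩

theorem isLowerSemicomputable_of_approx {Q : α × ℕ × ℕ → Prop}
    (hQ : REPred Q) (h_of_lt : ∀ a (m n : ℕ), (m / (n + 1) : ℝ) < f a → Q (a, m, n))
    (h_le : ∀ a (m n : ℕ), Q (a, m, n) → (m / (n + 1) : ℝ) ≤ f a) : IsLowerSemicomputable f := by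
  have h : REPred fun x : α × ℕ × ℕ => ∃ z : ℕ × ℕ,
      x.2.1 * (z.2 + 1) < z.1 * (x.2.2 + 1) ∧ Q (x.1, z) :=
    rePred_exists (rePred_and (rePred_lt (by fun_prop) (by fun_prop))
      (rePred_comp hQ (by fun_prop)))
  refine h.of_eq fun ⟨a, m, n⟩ => ⟨?_, fun hlt => ?_⟩
  · rintro ⟨z, hz, hQz⟩
    exact ((nat_div_lt_nat_div_iff _ _ _ _).2 hz).trans_le (h_le _ _ _ hQz)
  · obtain ⟨m', n', hlt', hlt''⟩ := exists_nat_div_btwn (by positivity) hlt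
    exact ⟨(m', n'), (nat_div_lt_nat_div_iff _ _ _ _).1 hlt', h_of_lt _ _ _ hlt''⟩

theorem ratNum_add_lt_div_iff (q n A B : ℕ) :
    ratNum q + 2 * (1 / 2 : ℝ) ^ n < A / (B + 1) ↔
      (q.unpair.1.unpair.1 * 2 ^ n + 2 * (q.unpair.2 + 1)) * (B + 1) <
        (A * (q.unpair.2 + 1) + q.unpair.1.unpair.2 * (B + 1)) * 2 ^ n := by
  rw [← Nat.cast_lt (α := ℝ), ratNum, one_div, inv_pow]
  push_cast
  field_simp
  constructor <;> intro h <;> linarith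

theorem div_lt_ratNum_sub_iff (q n A B : ℕ) :
    (A / (B + 1) : ℝ) < ratNum q - 2 * (1 / 2 : ℝ) ^ n ↔
      A * (q.unpair.2 + 1) * 2 ^ n +
          (q.unpair.1.unpair.2 * 2 ^ n + 2 * (q.unpair.2 + 1)) * (B + 1) <
        q.unpair.1.unpair.1 * 2 ^ n * (B + 1) := by
  rw [← Nat.cast_lt (α := ℝ), ratNum, one_div, inv_pow]
  push_cast
  field_simp
  constructor <;> intro h <;> linarith

variable {g : α × ℕ → ℕ}

theorem computable_approximation_args (hg : Computable g) :
    Computable fun x : (α × ℕ × ℕ) × ℕ => (g (x.1.1, x.2), x.2, x.1.2) := by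
  have h_fst : Primrec fun x : (α × ℕ × ℕ) × ℕ => (x.1.1, x.2) := by fun_prop
  have h_snd : Primrec fun x : (α × ℕ × ℕ) × ℕ => (x.2, x.1.2) := by fun_prop
  exact (hg.comp h_fst.to_comp).pair h_snd.to_comp

theorem isUpperSemicomputable_of_isCauchyName (hg : Computable g)
    (h : ∀ a, IsCauchyName ratNum (fun n => g (a, n)) (f a)) : IsUpperSemicomputable f := by
  have h_dec : REPred fun y : ℕ × ℕ × ℕ × ℕ =>
      ratNum y.1 + 2 * (1 / 2 : ℝ) ^ y.2.1 < y.2.2.1 / (y.2.2.2 + 1) := by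
    simp only [ratNum_add_lt_div_iff]
    exact rePred_lt (by fun_prop) (by fun_prop)
  have h_comp : REPred fun x : (α × ℕ × ℕ) × ℕ =>
      ratNum (g (x.1.1, x.2)) + 2 * (1 / 2 : ℝ) ^ x.2 < x.1.2.1 / (x.1.2.2 + 1) :=
    (rePred_comp_computable h_dec (computable_approximation_args hg) :)
  have h_ex : REPred fun x : α × ℕ × ℕ =>
      ∃ n, ratNum (g (x.1, n)) + 2 * (1 / 2 : ℝ) ^ n < x.2.1 / (x.2.2 + 1) :=
    rePred_exists h_comp
  refine h_ex.of_eq fun x => ⟨?_, fun hlt => ?_⟩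
  · rintro ⟨n, hn⟩
    have := abs_lt.1 ((h x.1).dist_lt n)
    linarith
  · have h_lim := (h x.1).2.add tendsto_two_mul_half_pow
    rw [add_zero] at h_lim
    exact (h_lim.eventually_lt_const hlt).exists

theorem isLowerSemicomputable_of_isCauchyName (hg : Computable g)
    (h : ∀ a, IsCauchyName ratNum (fun n => g (a, n)) (f a)) : IsLowerSemicomputable f := by
  have h_dec : REPred fun y : ℕ × ℕ × ℕ × ℕ =>
      (y.2.2.1 / (y.2.2.2 + 1) : ℝ) < ratNum y.1 - 2 * (1 / 2 : ℝ) ^ y.2.1 := by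
    simp only [div_lt_ratNum_sub_iff]
    exact rePred_lt (by fun_prop) (by fun_prop)
  have h_comp : REPred fun x : (α × ℕ × ℕ) × ℕ =>
      (x.1.2.1 / (x.1.2.2 + 1) : ℝ) < ratNum (g (x.1.1, x.2)) - 2 * (1 / 2 : ℝ) ^ x.2 :=
    (rePred_comp_computable h_dec (computable_approximation_args hg) :)
  have h_ex : REPred fun x : α × ℕ × ℕ =>
      ∃ n, (x.2.1 / (x.2.2 + 1) : ℝ) < ratNum (g (x.1, n)) - 2 * (1 / 2 : ℝ) ^ n :=
    rePred_exists h_comp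
  refine h_ex.of_eq fun x => ⟨?_, fun hlt => ?_⟩
  · rintro ⟨n, hn⟩
    have := abs_lt.1 ((h x.1).dist_lt n)
    linarith
  · have h_lim := (h x.1).2.sub tendsto_two_mul_half_pow
    rw [sub_zero] at h_lim
    exact (h_lim.eventually_const_lt hlt).exists

end Semicomputable

section Ideal

variable {X : Type*} [MetricSpace X] [CompleteSpace X] (S : ComputableMetricSpace X)

theorem isUpperSemicomputable_dist_ideal :
    IsUpperSemicomputable fun x : ℕ × ℕ => dist (S.ideal x.1) (S.ideal x.2) := by
  obtain ⟨f, hf, h⟩ := S.dist_computable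
  have h_assoc : Primrec fun y : (ℕ × ℕ) × ℕ => (y.1.1, y.1.2, y.2) := by fun_prop
  exact isUpperSemicomputable_of_isCauchyName (hf.comp h_assoc.to_comp) fun x => h x.1 x.2

theorem isLowerSemicomputable_dist_ideal :
    IsLowerSemicomputable fun x : ℕ × ℕ => dist (S.ideal x.1) (S.ideal x.2) := by
  obtain ⟨f, hf, h⟩ := S.dist_computable
  have h_assoc : Primrec fun y : (ℕ × ℕ) × ℕ => (y.1.1, y.1.2, y.2) := by fun_prop
  exact isLowerSemicomputable_of_isCauchyName (hf.comp h_assoc.to_comp) fun x => h x.1 x.2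

end Ideal

section Prokhorov

variable {X : Type*} [MetricSpace X] [MeasurableSpace X] [BorelSpace X]
  {μ ν : LevyProkhorov (ProbabilityMeasure X)} {δ : ℝ}

theorem dist_le_of_forall_measureReal_le (hδ : 0 ≤ δ) (h : ∀ B, MeasurableSet B →
      (μ.toMeasure : Measure X).real B ≤
        (ν.toMeasure : Measure X).real (Metric.thickening δ B) + δ) :
    dist μ ν ≤ δ := by
  rw [LevyProkhorov.dist_probabilityMeasure_def]
  refine levyProkhorovDist_le_of_forall_le _ _ hδ fun ε B hε hB => ?_
  have h_mono := measureReal_mono (μ := (ν.toMeasure : Measure X))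
    (Metric.thickening_mono hε.le B)
  rw [← ofReal_measureReal, ← ofReal_measureReal (s := Metric.thickening ε B),
    ← ENNReal.ofReal_add measureReal_nonneg (hδ.trans hε.le)]
  exact ENNReal.ofReal_le_ofReal ((h B hB).trans (add_le_add h_mono hε.le))

theorem measure_le_of_dist_lt (h : dist μ ν < δ) {B : Set X} (hB : MeasurableSet B) :
    (μ.toMeasure : Measure X) B ≤
      (ν.toMeasure : Measure X) (Metric.thickening δ B) + ENNReal.ofReal δ := by
  have hδ : 0 < δ := dist_nonneg.trans_lt h
  have h_edist : levyProkhorovEDist (μ.toMeasure : Measure X) (ν.toMeasure : Measure X) <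
      ENNReal.ofReal δ := by
    rw [← LevyProkhorov.edist_probabilityMeasure_def, edist_dist]
    exact (ENNReal.ofReal_lt_ofReal_iff hδ).2 h
  simpa [ENNReal.toReal_ofReal hδ.le] using left_measure_le_of_levyProkhorovEDist_lt h_edist hB

theorem measureReal_le_of_dist_lt (h : dist μ ν < δ) {B : Set X} (hB : MeasurableSet B) :
    (μ.toMeasure : Measure X).real B ≤
      (ν.toMeasure : Measure X).real (Metric.thickening δ B) + δ := by
  have hδ : 0 ≤ δ := dist_nonneg.trans h.le
  have h_le := measure_le_of_dist_lt h hB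
  rw [← ofReal_measureReal, ← ofReal_measureReal (s := Metric.thickening δ B),
    ← ENNReal.ofReal_add measureReal_nonneg hδ] at h_le
  exact (ENNReal.ofReal_le_ofReal_iff (add_nonneg measureReal_nonneg hδ)).1 h_le

end Prokhorov

/-- The total weight of a list of pairs (index, weight), the weight `w` counting as `w + 1` as in
`weightedSum`. -/
def totalWeight (l : List (ℕ × ℕ)) : ℕ := (l.map fun e => e.2 + 1).sum

section TotalWeight

@[fun_prop]
theorem primrec_totalWeight {α : Type*} [Primcodable α] {f : α → List (ℕ × ℕ)} (hf : Primrec f) :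
    Primrec fun a => totalWeight (f a) := by
  have h_step : Primrec₂ fun (_ : α) (x : (ℕ × ℕ) × ℕ) => x.1.2 + 1 + x.2 := by
    change Primrec fun y : α × (ℕ × ℕ) × ℕ => y.2.1.2 + 1 + y.2.2
    fun_prop
  refine (Primrec.list_foldr hf (Primrec.const 0) h_step).of_eq fun a => ?_
  unfold totalWeight
  induction f a with
  | nil => rfl
  | cons b l ih => simp only [List.foldr_cons, ih, List.map_cons, List.sum_cons]

@[fun_prop]
theorem primrec_weightList {α : Type*} [Primcodable α] {f : α → ℕ} (hf : Primrec f) :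
    Primrec fun a => weightList (f a) := by
  unfold weightList
  fun_prop

theorem totalWeight_le_of_sublist {l l' : List (ℕ × ℕ)} (h : l.Sublist l') :
    totalWeight l ≤ totalWeight l' :=
  (h.map _).sum_le_sum fun _ _ => Nat.zero_le _

theorem totalWeight_weightList_pos (n : ℕ) : 0 < totalWeight (weightList n) := by
  simp [totalWeight, weightList]

theorem exists_weightList_eq {l : List (ℕ × ℕ)} (hl : l ≠ []) : ∃ n, weightList n = l := by
  cases l with
  | nil => exact absurd rfl hl
  | cons a l =>
    exact ⟨Nat.pair (Nat.pair a.1 a.2) (Encodable.encode l), by simp [weightList]⟩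

end TotalWeight

section WeightedSum

variable {X : Type*} [MeasurableSpace X]

theorem weightedSum_apply [MeasurableSingletonClass X] (s : ℕ → X) (l : List (ℕ × ℕ)) (A : Set X)
    [DecidablePred (· ∈ A)] :
    weightedSum s l A = totalWeight (l.filter fun e => s e.1 ∈ A) := by
  induction l with
  | nil => simp [weightedSum, totalWeight]
  | cons a l ih => by_cases h : s a.1 ∈ A <;> simp [weightedSum, ih, h, totalWeight]

theorem weightedSum_univ (s : ℕ → X) (l : List (ℕ × ℕ)) :
    weightedSum s l Set.univ = totalWeight l := by
  induction l with
  | nil => simp [weightedSum, totalWeight]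
  | cons a l ih => simp [weightedSum, ih, totalWeight]

end WeightedSum

section IdealMeasure

variable {X : Type*} [MetricSpace X] [CompleteSpace X] [MeasurableSpace X]
  (S : ComputableMetricSpace X)

theorem idealMeasure_eq_smul (n : ℕ) : ((idealMeasure S n).toMeasure : Measure X) =
    (totalWeight (weightList n) : ℝ≥0∞)⁻¹ • weightedSum S.ideal (weightList n) := by
  rw [← weightedSum_univ S.ideal]
  rfl

variable [BorelSpace X]

theorem idealMeasure_real (n : ℕ) (A : Set X) [DecidablePred (· ∈ A)] :
    ((idealMeasure S n).toMeasure : Measure X).real A =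
      totalWeight ((weightList n).filter fun e => S.ideal e.1 ∈ A) /
        totalWeight (weightList n) := by
  rw [idealMeasure_eq_smul, measureReal_def, Measure.smul_apply, weightedSum_apply]
  simp [div_eq_inv_mul]

theorem le_idealMeasure_real {n : ℕ} {A : Set X} {l : List (ℕ × ℕ)}
    (hl : l.Sublist (weightList n)) (hA : ∀ e ∈ l, S.ideal e.1 ∈ A) :
    (totalWeight l : ℝ) / totalWeight (weightList n) ≤
      ((idealMeasure S n).toMeasure : Measure X).real A := by
  classical
  have h_filter : l.filter (fun e => S.ideal e.1 ∈ A) = l :=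
    List.filter_eq_self.2 (by simpa using hA)
  rw [idealMeasure_real]
  gcongr
  exact totalWeight_le_of_sublist (h_filter ▸ hl.filter _)

theorem measurableSet_exists_mem_ideal_eq (C : List (ℕ × ℕ)) :
    MeasurableSet {p | ∃ e ∈ C, S.ideal e.1 = p} :=
  ((List.finite_toSet C).image fun e : ℕ × ℕ => S.ideal e.1).measurableSet

variable {a b : ℕ} {δ : ℝ}

theorem exists_sublist_of_dist_idealMeasure_lt
    (h : dist (idealMeasure S a) (idealMeasure S b) < δ) {C : List (ℕ × ℕ)}
    (hC : C.Sublist (weightList a)) :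
    ∃ D, D.Sublist (weightList b) ∧
      (∀ e ∈ D, ∃ e' ∈ C, dist (S.ideal e.1) (S.ideal e'.1) < δ) ∧
      (totalWeight C / totalWeight (weightList a) : ℝ) ≤
        totalWeight D / totalWeight (weightList b) + δ := by
  classical
  set K : Set X := {p | ∃ e ∈ C, S.ideal e.1 = p}
  refine ⟨(weightList b).filter fun e => S.ideal e.1 ∈ Metric.thickening δ K,
    List.filter_sublist, fun e he => ?_, ?_⟩
  · obtain ⟨-, he⟩ := List.mem_filter.1 he
    obtain ⟨_, ⟨e', he', rfl⟩, h_dist⟩ := Metric.mem_thickening_iff.1 (of_decide_eq_true he)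
    exact ⟨e', he', h_dist⟩
  · rw [← idealMeasure_real]
    exact (le_idealMeasure_real S hC (A := K) fun e he => ⟨e, he, rfl⟩).trans
      (measureReal_le_of_dist_lt h (measurableSet_exists_mem_ideal_eq S C))

theorem dist_idealMeasure_le_of_forall_sublist (hδ : 0 ≤ δ)
    (h : ∀ C, C.Sublist (weightList a) → ∃ D, D.Sublist (weightList b) ∧
      (∀ e ∈ D, ∃ e' ∈ C, dist (S.ideal e.1) (S.ideal e'.1) < δ) ∧
      (totalWeight C / totalWeight (weightList a) : ℝ) ≤
        totalWeight D / totalWeight (weightList b) + δ) :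
    dist (idealMeasure S a) (idealMeasure S b) ≤ δ := by
  classical
  refine dist_le_of_forall_measureReal_le hδ fun K _ => ?_
  obtain ⟨D, hD, h_near, h_le⟩ := h ((weightList a).filter fun e => S.ideal e.1 ∈ K)
    List.filter_sublist
  rw [← idealMeasure_real] at h_le
  refine h_le.trans (add_le_add_left (le_idealMeasure_real S hD fun e he => ?_) δ)
  obtain ⟨e', he', h_dist⟩ := h_near e he
  exact Metric.mem_thickening_iff.2 ⟨_, of_decide_eq_true (List.mem_filter.1 he').2, h_dist⟩

theorem exists_separated_of_lt_dist_idealMeasure (hδ : 0 ≤ δ)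
    (h : δ < dist (idealMeasure S a) (idealMeasure S b)) :
    ∃ C D : List (ℕ × ℕ), C.Sublist (weightList a) ∧ D.Sublist (weightList b) ∧
      (∀ e ∈ D, ∀ e' ∈ C, δ < dist (S.ideal e.1) (S.ideal e'.1)) ∧
      (1 + δ : ℝ) < totalWeight C / totalWeight (weightList a) +
        totalWeight D / totalWeight (weightList b) := by
  classical
  obtain ⟨δ', hδδ', h⟩ := exists_between h
  have h_exists : ∃ K, MeasurableSet K ∧
      ((idealMeasure S b).toMeasure : Measure X).real (Metric.thickening δ' K) + δ' <
        ((idealMeasure S a).toMeasure : Measure X).real K := by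
    by_contra! h_all
    exact h.not_ge (dist_le_of_forall_measureReal_le (hδ.trans hδδ'.le) h_all)
  obtain ⟨K, -, hK⟩ := h_exists
  refine ⟨(weightList a).filter fun e => S.ideal e.1 ∈ K,
    (weightList b).filter fun e => S.ideal e.1 ∈ (Metric.thickening δ' K)ᶜ,
    List.filter_sublist, List.filter_sublist, fun e he e' he' => ?_, ?_⟩
  · refine hδδ'.trans_le (le_of_not_gt fun h_dist => ?_)
    exact of_decide_eq_true (List.mem_filter.1 he).2
      (Metric.mem_thickening_iff.2 ⟨_, of_decide_eq_true (List.mem_filter.1 he').2, h_dist⟩)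
  · rw [← idealMeasure_real, ← idealMeasure_real,
      probReal_compl_eq_one_sub Metric.isOpen_thickening.measurableSet]
    linarith

theorem le_dist_idealMeasure_of_separated {C D : List (ℕ × ℕ)} (hC : C.Sublist (weightList a))
    (hD : D.Sublist (weightList b))
    (h_sep : ∀ e ∈ D, ∀ e' ∈ C, δ < dist (S.ideal e.1) (S.ideal e'.1))
    (h_mass : (1 + δ : ℝ) < totalWeight C / totalWeight (weightList a) +
      totalWeight D / totalWeight (weightList b)) :
    δ ≤ dist (idealMeasure S a) (idealMeasure S b) := by
  by_contra! h
  set K : Set X := {p | ∃ e ∈ C, S.ideal e.1 = p}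
  have h_thick := measureReal_le_of_dist_lt h (measurableSet_exists_mem_ideal_eq S C)
  have h_massC := le_idealMeasure_real S hC (A := K) fun e he => ⟨e, he, rfl⟩
  have h_massD := le_idealMeasure_real S hD (A := (Metric.thickening δ K)ᶜ) fun e he h_mem => by
    obtain ⟨_, ⟨e', he', rfl⟩, h_dist⟩ := Metric.mem_thickening_iff.1 h_mem
    exact h_dist.not_gt (h_sep e he e' he')
  rw [probReal_compl_eq_one_sub Metric.isOpen_thickening.measurableSet] at h_massD
  linarith

end IdealMeasure

section IdealMeasureDist

variable {X : Type*} [MetricSpace X] [CompleteSpace X] [MeasurableSpace X] [BorelSpace X]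
  (S : ComputableMetricSpace X)

theorem totalWeight_div_le_iff (a b m n : ℕ) (C D : List (ℕ × ℕ)) :
    (totalWeight C / totalWeight (weightList a) : ℝ) ≤
        totalWeight D / totalWeight (weightList b) + m / (n + 1) ↔
      totalWeight C * totalWeight (weightList b) * (n + 1) ≤
        (totalWeight D * (n + 1) + m * totalWeight (weightList b)) *
          totalWeight (weightList a) := by
  have ha : (0 : ℝ) < totalWeight (weightList a) := by
    exact_mod_cast totalWeight_weightList_pos a
  have hb : (0 : ℝ) < totalWeight (weightList b) := by
    exact_mod_cast totalWeight_weightList_pos b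
  rw [← Nat.cast_le (α := ℝ)]
  push_cast
  field_simp

theorem one_add_div_lt_totalWeight_iff (a b m n : ℕ) (C D : List (ℕ × ℕ)) :
    (1 + m / (n + 1) : ℝ) < totalWeight C / totalWeight (weightList a) +
        totalWeight D / totalWeight (weightList b) ↔
      (n + 1 + m) * (totalWeight (weightList a) * totalWeight (weightList b)) <
        (totalWeight C * totalWeight (weightList b) +
          totalWeight (weightList a) * totalWeight D) * (n + 1) := by
  have ha : (0 : ℝ) < totalWeight (weightList a) := by
    exact_mod_cast totalWeight_weightList_pos a
  have hb : (0 : ℝ) < totalWeight (weightList b) := by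
    exact_mod_cast totalWeight_weightList_pos b
  rw [← Nat.cast_lt (α := ℝ)]
  push_cast
  field_simp

theorem isUpperSemicomputable_dist_idealMeasure :
    IsUpperSemicomputable fun x : ℕ × ℕ => dist (idealMeasure S x.1) (idealMeasure S x.2) := by
  let Q : (ℕ × ℕ) × ℕ × ℕ → Prop := fun x =>
    ∀ C ∈ (weightList x.1.1).sublists', ∃ D ∈ (weightList x.1.2).sublists',
      (∀ e ∈ D, ∃ e' ∈ C, dist (S.ideal e.1) (S.ideal e'.1) < x.2.1 / (x.2.2 + 1)) ∧
      (totalWeight C / totalWeight (weightList x.1.1) : ℝ) ≤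
        totalWeight D / totalWeight (weightList x.1.2) + x.2.1 / (x.2.2 + 1)
  have hQ : REPred Q := by
    simp only [Q, totalWeight_div_le_iff]
    refine rePred_forall_mem (rePred_exists_mem (rePred_and (rePred_forall_mem
      (rePred_exists_mem ?_ (by fun_prop)) (by fun_prop)) (rePred_le (by fun_prop)
      (by fun_prop))) (by fun_prop)) (by fun_prop)
    exact rePred_comp (f := fun y : (((((ℕ × ℕ) × ℕ × ℕ) × List (ℕ × ℕ)) × List (ℕ × ℕ)) ×
      ℕ × ℕ) × ℕ × ℕ => ((y.1.2.1, y.2.1), y.1.1.1.1.2)) (isUpperSemicomputable_dist_ideal S)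
      (by fun_prop)
  refine isUpperSemicomputable_of_approx (fun _ => dist_nonneg) hQ (fun x m n h C hC => ?_)
    fun x m n h => dist_idealMeasure_le_of_forall_sublist S (by positivity) fun C hC => ?_
  · obtain ⟨D, hD, h⟩ := exists_sublist_of_dist_idealMeasure_lt S h (List.mem_sublists'.1 hC)
    exact ⟨D, List.mem_sublists'.2 hD, h⟩
  · obtain ⟨D, hD, h⟩ := h C (List.mem_sublists'.2 hC)
    exact ⟨D, List.mem_sublists'.1 hD, h⟩

theorem isLowerSemicomputable_dist_idealMeasure :
    IsLowerSemicomputable fun x : ℕ × ℕ => dist (idealMeasure S x.1) (idealMeasure S x.2) := by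
  let Q : (ℕ × ℕ) × ℕ × ℕ → Prop := fun x =>
    ∃ C ∈ (weightList x.1.1).sublists', ∃ D ∈ (weightList x.1.2).sublists',
      (∀ e ∈ D, ∀ e' ∈ C, (x.2.1 / (x.2.2 + 1) : ℝ) < dist (S.ideal e.1) (S.ideal e'.1)) ∧
      (1 + x.2.1 / (x.2.2 + 1) : ℝ) < totalWeight C / totalWeight (weightList x.1.1) +
        totalWeight D / totalWeight (weightList x.1.2)
  have hQ : REPred Q := by
    simp only [Q, one_add_div_lt_totalWeight_iff]
    refine rePred_exists_mem (rePred_exists_mem (rePred_and (rePred_forall_mem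
      (rePred_forall_mem ?_ (by fun_prop)) (by fun_prop)) (rePred_lt (by fun_prop)
      (by fun_prop))) (by fun_prop)) (by fun_prop)
    exact rePred_comp (f := fun y : (((((ℕ × ℕ) × ℕ × ℕ) × List (ℕ × ℕ)) × List (ℕ × ℕ)) ×
      ℕ × ℕ) × ℕ × ℕ => ((y.1.2.1, y.2.1), y.1.1.1.1.2)) (isLowerSemicomputable_dist_ideal S)
      (by fun_prop)
  refine isLowerSemicomputable_of_approx hQ (fun x m n h => ?_) fun x m n h => ?_
  · obtain ⟨C, D, hC, hD, h⟩ := exists_separated_of_lt_dist_idealMeasure S (by positivity) h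
    exact ⟨C, List.mem_sublists'.2 hC, D, List.mem_sublists'.2 hD, h⟩
  · obtain ⟨C, hC, D, hD, h_sep, h_mass⟩ := h
    exact le_dist_idealMeasure_of_separated S (List.mem_sublists'.1 hC) (List.mem_sublists'.1 hD)
      h_sep h_mass

end IdealMeasureDist

section Lintegral

variable {X : Type*} [MeasurableSpace X]

theorem lintegral_weightedSum (s : ℕ → X) (l : List (ℕ × ℕ)) {f : X → ℝ≥0∞} (hf : Measurable f) :
    ∫⁻ x, f x ∂weightedSum s l = (l.map fun e => ((e.2 : ℝ≥0∞) + 1) * f (s e.1)).sum := by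
  induction l with
  | nil => simp [weightedSum]
  | cons a l ih => simp [weightedSum, ih, lintegral_dirac' _ hf]

theorem lintegral_ofReal_le_of_dist_lt [MetricSpace X] [BorelSpace X]
    {μ ν : LevyProkhorov (ProbabilityMeasure X)} {ε Q : ℝ} (h : dist μ ν < ε) {f g : X → ℝ}
    (hf : Measurable f) (hg : Measurable g) (hf_nonneg : 0 ≤ f) (hg_nonneg : 0 ≤ g)
    (hf_le : ∀ x, f x ≤ Q) (hfg : ∀ x y, dist y x < ε → f x ≤ g y) :
    ∫⁻ x, ENNReal.ofReal (f x) ∂(μ.toMeasure : Measure X) ≤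
      ∫⁻ x, ENNReal.ofReal (g x) ∂(ν.toMeasure : Measure X) +
        ENNReal.ofReal ε * ENNReal.ofReal Q := by
  rw [lintegral_eq_lintegral_meas_lt _ (Eventually.of_forall hf_nonneg) hf.aemeasurable,
    lintegral_eq_lintegral_meas_lt _ (Eventually.of_forall hg_nonneg) hg.aemeasurable]
  calc ∫⁻ t in Set.Ioi 0, (μ.toMeasure : Measure X) {x | t < f x}
      ≤ ∫⁻ t in Set.Ioi 0, ((ν.toMeasure : Measure X) {x | t < g x} +
          (Set.Iio Q).indicator (fun _ => ENNReal.ofReal ε) t) := by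
        refine lintegral_mono fun t => ?_
        rcases lt_or_ge t Q with ht | ht
        · simp only [Set.indicator_of_mem (Set.mem_Iio.2 ht)]
          refine (measure_le_of_dist_lt h (hf measurableSet_Ioi)).trans ?_
          gcongr
          intro y hy
          obtain ⟨x, hx, hxy⟩ := Metric.mem_thickening_iff.1 hy
          exact lt_of_lt_of_le hx (hfg x y hxy)
        · have h_empty : {x | t < f x} = ∅ :=
            Set.eq_empty_of_forall_notMem fun x hx => (hf_le x).not_gt (ht.trans_lt hx)
          simp only [h_empty, measure_empty, zero_le]
    _ = _ := by
        rw [lintegral_add_right _ (measurable_const.indicator measurableSet_Iio),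
          lintegral_indicator measurableSet_Iio, setLIntegral_const,
          Measure.restrict_apply measurableSet_Iio, Set.Iio_inter_Ioi, Real.volume_Ioo, sub_zero]

end Lintegral

section Density

variable {X : Type*} [MeasurableSpace X]

theorem exists_disjoint_subset_ball_measureReal_gt [MetricSpace X] [OpensMeasurableSpace X]
    {s : ℕ → X} (hs : DenseRange s) (μ : Measure X) [IsProbabilityMeasure μ] {η : ℝ} (hη : 0 < η) :
    ∃ (N : ℕ) (D : ℕ → Set X), (∀ i, D i ⊆ Metric.ball (s i) η) ∧ (∀ i, MeasurableSet (D i)) ∧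
      Pairwise (Function.onFun Disjoint D) ∧
      1 - η < μ.real (⋃ i ∈ Finset.range (N + 1), D i) := by
  have h_cover : ⋃ i, Metric.ball (s i) η = Set.univ :=
    Set.eq_univ_of_forall fun x => Set.mem_iUnion.2 (hs.exists_dist_lt x hη)
  have h_tendsto := (ENNReal.tendsto_toReal (measure_ne_top μ _)).comp
    (tendsto_measure_iUnion_accumulate (μ := μ) (f := fun i => Metric.ball (s i) η))
  rw [h_cover, measure_univ, ENNReal.toReal_one] at h_tendsto
  obtain ⟨N, hN⟩ := (h_tendsto.eventually_const_lt (sub_lt_self 1 hη)).exists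
  refine ⟨N, disjointed fun i => Metric.ball (s i) η, disjointed_subset _,
    MeasurableSet.disjointed fun _ => Metric.isOpen_ball.measurableSet, disjoint_disjointed _, ?_⟩
  rw [biUnion_range_succ_disjointed, Set.partialSups_eq_accumulate]
  exact hN

open Classical in
theorem measureReal_le_sum_measureReal_add {ι : Type*} (μ : Measure X) [IsProbabilityMeasure μ]
    {I : Finset ι} {D : ι → Set X} (hD : ∀ i, MeasurableSet (D i)) {η : ℝ}
    (h : 1 - η < μ.real (⋃ i ∈ I, D i)) (A : Set X) :
    μ.real A ≤ ∑ i ∈ I.filter fun i => (A ∩ D i).Nonempty, μ.real (D i) + η := by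
  have h_subset : A ⊆ (⋃ i ∈ I.filter fun i => (A ∩ D i).Nonempty, D i) ∪ (⋃ i ∈ I, D i)ᶜ := by
    intro x hxA
    by_cases hx : x ∈ ⋃ i ∈ I, D i
    · obtain ⟨i, hi, hxD⟩ := Set.mem_iUnion₂.1 hx
      exact Or.inl (Set.mem_biUnion (Finset.mem_filter.2 ⟨hi, x, hxA, hxD⟩) hxD)
    · exact Or.inr hx
  refine (measureReal_mono h_subset).trans ((measureReal_union_le _ _).trans ?_)
  rw [probReal_compl_eq_one_sub (Finset.measurableSet_biUnion _ fun i _ => hD i)]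
  exact add_le_add (measureReal_biUnion_finset_le _ _) (by linarith)

end Density

theorem exists_nat_weights_sum_le {ι : Type*} {I : Finset ι} {p : ι → ℝ} (hp : ∀ i, 0 ≤ p i)
    (hI : ∑ i ∈ I, p i ≤ 1) {η : ℝ} (hη : 0 < η) :
    ∃ w : ι → ℕ, ∀ F ⊆ I, ∑ i ∈ F, p i ≤ (∑ i ∈ F, (w i + 1 : ℝ)) / ∑ i ∈ I, (w i + 1 : ℝ) + η := by
  obtain ⟨K, hK⟩ := exists_nat_gt (I.card / η)
  have hK_pos : (0 : ℝ) < K := lt_of_le_of_lt (by positivity) hK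
  refine ⟨fun i => ⌊K * p i⌋₊, fun F hF => ?_⟩
  set u : ι → ℝ := fun i => (⌊K * p i⌋₊ : ℝ) + 1
  have hu : ∀ i, 0 < u i := fun i => by positivity
  have h_sum_le : ∑ i ∈ F, u i ≤ ∑ i ∈ I, u i :=
    Finset.sum_le_sum_of_subset_of_nonneg hF fun i _ _ => (hu i).le
  have h_total : ∑ i ∈ I, u i ≤ K * (1 + η) := by
    calc ∑ i ∈ I, u i ≤ ∑ i ∈ I, (K * p i + 1) :=
          Finset.sum_le_sum fun i _ =>
            add_le_add_left (Nat.floor_le (mul_nonneg hK_pos.le (hp i))) 1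
      _ = K * ∑ i ∈ I, p i + I.card := by simp [Finset.sum_add_distrib, Finset.mul_sum]
      _ ≤ K * 1 + K * η := by gcongr; exact ((div_lt_iff₀ hη).1 hK).le
      _ = K * (1 + η) := by ring
  calc ∑ i ∈ F, p i ≤ (∑ i ∈ F, u i) / K := by
        rw [Finset.sum_div]
        exact Finset.sum_le_sum fun i _ =>
          (le_div_iff₀' hK_pos).2 (Nat.lt_floor_add_one _).le
    _ = (∑ i ∈ F, u i) / (∑ i ∈ I, u i) * ((∑ i ∈ I, u i) / K) := by
        rcases I.eq_empty_or_nonempty with rfl | hI_nonempty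
        · simp [Finset.subset_empty.1 hF]
        · rw [div_mul_div_cancel₀ (Finset.sum_pos (fun i _ => hu i) hI_nonempty).ne']
    _ ≤ (∑ i ∈ F, u i) / (∑ i ∈ I, u i) * (1 + η) := by
        have h_nonneg : ∀ F' : Finset ι, 0 ≤ ∑ i ∈ F', u i :=
          fun F' => Finset.sum_nonneg fun i _ => (hu i).le
        exact mul_le_mul_of_nonneg_left ((div_le_iff₀' hK_pos).2 h_total)
          (div_nonneg (h_nonneg F) (h_nonneg I))
    _ ≤ (∑ i ∈ F, u i) / (∑ i ∈ I, u i) + η := by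
        rw [mul_one_add]
        gcongr
        exact mul_le_of_le_one_left hη.le
          (div_le_one_of_le₀ h_sum_le (Finset.sum_nonneg fun i _ => (hu i).le))

theorem totalWeight_map_prodMk (w : ℕ → ℕ) {l : List ℕ} (hl : l.Nodup) :
    (totalWeight (l.map fun i => (i, w i)) : ℝ) = ∑ i ∈ l.toFinset, (w i + 1 : ℝ) := by
  rw [List.sum_toFinset _ hl, totalWeight, List.map_map, Nat.cast_list_sum, List.map_map]
  simp [Function.comp_def]

theorem denseRange_idealMeasure {X : Type*} [MetricSpace X] [CompleteSpace X] [MeasurableSpace X]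
    [BorelSpace X] (S : ComputableMetricSpace X) : DenseRange (idealMeasure S) := by
  classical
  refine Metric.denseRange_iff.2 fun μ ε hε => ?_
  have hη : 0 < ε / 3 := by positivity
  obtain ⟨N, D, hD_ball, hD_meas, hD_disj, hD_mass⟩ :=
    exists_disjoint_subset_ball_measureReal_gt S.dense (μ.toMeasure : Measure X) hη
  have h_sum_le : ∑ i ∈ Finset.range (N + 1), (μ.toMeasure : Measure X).real (D i) ≤ 1 := by
    rw [← measureReal_biUnion_finset (fun i _ j _ hij => hD_disj hij) fun i _ => hD_meas i]
    exact measureReal_le_one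
  obtain ⟨w, hw⟩ := exists_nat_weights_sum_le (fun _ => measureReal_nonneg) h_sum_le hη
  obtain ⟨n, hn⟩ := exists_weightList_eq (l := (List.range (N + 1)).map fun i => (i, w i))
    (by simp)
  suffices h : dist μ (idealMeasure S n) ≤ 2 * (ε / 3) from ⟨n, by linarith⟩
  refine dist_le_of_forall_measureReal_le (by positivity) fun A _ => ?_
  let l := (List.range (N + 1)).filter fun i => (A ∩ D i).Nonempty
  have hl : l.toFinset = (Finset.range (N + 1)).filter fun i => (A ∩ D i).Nonempty := by
    simp only [l, List.toFinset_filter, List.toFinset_range, decide_eq_true_eq]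
  have h_ideal := le_idealMeasure_real S (n := n) (A := Metric.thickening (2 * (ε / 3)) A)
    (l := l.map fun i => (i, w i)) (hn ▸ List.filter_sublist.map _) fun e he => by
      obtain ⟨i, hi, rfl⟩ := List.mem_map.1 he
      obtain ⟨x, hxA, hxD⟩ := of_decide_eq_true (List.mem_filter.1 hi).2
      have hx : dist x (S.ideal i) < ε / 3 := hD_ball i hxD
      exact Metric.mem_thickening_iff.2 ⟨x, hxA, by rw [dist_comm]; linarith⟩
  rw [hn, totalWeight_map_prodMk w (List.nodup_range.filter _),
    totalWeight_map_prodMk w List.nodup_range, hl, List.toFinset_range] at h_ideal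
  linarith [hw _ (Finset.filter_subset (fun i => (A ∩ D i).Nonempty) _),
    measureReal_le_sum_measureReal_add (μ.toMeasure : Measure X) hD_meas hD_mass A]

section Names

variable {Y : Type*} [PseudoMetricSpace Y] {s : ℕ → Y} {y : Y}

/-- Consecutive terms of the finite sequence `u` satisfy the condition which
`IsCauchyName` imposes on a name. -/
def IsNamePrefix (s : ℕ → Y) (u : List ℕ) : Prop :=
  ∀ j < u.length - 1, dist (s (u.getD j 0)) (s (u.getD (j + 1) 0)) < (1 / 2 : ℝ) ^ j

theorem IsCauchyName.isNamePrefix {σ : ℕ → ℕ} (h : IsCauchyName s σ y) (k : ℕ) :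
    IsNamePrefix s ((List.range k).map σ) := by
  intro j hj
  have hk : j + 1 < k := by simp at hj; omega
  have hk' : j < k := by omega
  simpa [hk, hk'] using h.1 j

theorem isCauchyName_of_dist_lt {σ : ℕ → ℕ}
    (h : ∀ n, dist (s (σ n)) y < (1 / 2 : ℝ) ^ (n + 1)) : IsCauchyName s σ y := by
  refine ⟨fun n => ?_, ?_⟩
  · have h_succ : (1 / 2 : ℝ) ^ (n + 1 + 1) ≤ (1 / 2) ^ (n + 1) :=
      pow_le_pow_of_le_one (by norm_num) (by norm_num) (Nat.le_succ _)
    calc dist (s (σ n)) (s (σ (n + 1))) ≤ dist (s (σ n)) y + dist (s (σ (n + 1))) y :=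
          dist_triangle_right _ _ _
      _ < (1 / 2) ^ (n + 1) + (1 / 2) ^ (n + 1) := add_lt_add (h n) ((h (n + 1)).trans_le h_succ)
      _ = (1 / 2) ^ n := by ring
  · refine tendsto_iff_dist_tendsto_zero.2 (squeeze_zero (fun _ => dist_nonneg)
      (fun n => (h n).le) ?_)
    exact (tendsto_pow_atTop_nhds_zero_of_lt_one (by norm_num) (by norm_num)).comp
      (tendsto_add_atTop_nat 1)

theorem exists_forall_dist_lt (hs : DenseRange s) (y : Y) {r : ℕ → ℝ} (hr : ∀ n, 0 < r n) :
    ∃ σ : ℕ → ℕ, ∀ n, dist (s (σ n)) y < r n := by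
  simp only [dist_comm _ y]
  exact ⟨_, fun n => (hs.exists_dist_lt y (hr n)).choose_spec⟩

theorem IsNamePrefix.exists_isCauchyName (hs : DenseRange s) {u : List ℕ} {b : ℕ}
    (h : IsNamePrefix s (u ++ [b])) (hb : dist (s b) y < (1 / 2 : ℝ) ^ u.length) :
    ∃ σ, IsCauchyName s σ y ∧ (List.range (u.length + 1)).map σ = u ++ [b] := by
  obtain ⟨τ, hτ⟩ := exists_forall_dist_lt hs y
    (r := fun n => min ((1 / 2) ^ (n + 1)) ((1 / 2) ^ u.length - dist (s b) y))
    fun n => lt_min (by positivity) (sub_pos.2 hb)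
  have hτ_name : IsCauchyName s τ y :=
    isCauchyName_of_dist_lt fun n => (hτ n).trans_le (min_le_left _ _)
  have hτ_dist : ∀ n, dist (s b) (s (τ n)) < (1 / 2 : ℝ) ^ u.length := fun n => by
    have h_near := (hτ n).trans_le (min_le_right _ _)
    linarith [dist_triangle_right (s b) (s (τ n)) y]
  let σ : ℕ → ℕ := fun n => (u ++ [b]).getD n (τ n)
  have hσ_prefix : ∀ n ≤ u.length, ∀ a, (u ++ [b]).getD n a = σ n := fun n hn a => by
    have h_length : n < (u ++ [b]).length := by simp; omega
    simp only [σ, List.getD_eq_getElem _ _ h_length]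
  have hσ_last : σ u.length = b := by simp [σ]
  have hσ_tail : ∀ n > u.length, σ n = τ n := fun n hn =>
    List.getD_eq_default _ _ (by simp; omega)
  refine ⟨σ, ⟨fun n => ?_, hτ_name.2.congr' ?_⟩, ?_⟩
  · rcases lt_trichotomy n u.length with hn | rfl | hn
    · simpa only [hσ_prefix n hn.le, hσ_prefix (n + 1) hn] using h n (by simpa using hn)
    · rw [hσ_last, hσ_tail _ (Nat.lt_succ_self _)]
      exact hτ_dist _
    · rw [hσ_tail _ hn, hσ_tail _ (hn.trans (Nat.lt_succ_self _))]
      exact hτ_name.1 n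
  · filter_upwards [eventually_gt_atTop u.length] with n hn using by rw [hσ_tail n hn]
  · refine List.ext_getElem (by simp) fun n h₁ h₂ => ?_
    have hn : n ≤ u.length := by simp at h₁; omega
    simpa only [List.getElem_map, List.getElem_range, ← hσ_prefix n hn 0] using
      List.getD_eq_getElem _ _ h₂

end Names

section SublevelSup

variable {ι Z : Type*} {A A' : Finset ι} {v : ι → ℕ} {g : ι → Z → ℝ} {δ : ℝ} {z : Z}

open Classical in
/-- The supremum of the values `v j` over the `j ∈ A` for which `z` lies in the sublevel set
`{g j ≤ δ}`: a step function that is constant between the sublevel sets. -/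
noncomputable def sublevelSup (A : Finset ι) (v : ι → ℕ) (g : ι → Z → ℝ) (δ : ℝ) (z : Z) : ℕ :=
  {j ∈ A | g j z ≤ δ}.sup v

theorem sublevelSup_le_iff {n : ℕ} :
    sublevelSup A v g δ z ≤ n ↔ ∀ j ∈ A, g j z ≤ δ → v j ≤ n := by
  simp [sublevelSup]

theorem le_sublevelSup {j : ι} (hj : j ∈ A) (h : g j z ≤ δ) : v j ≤ sublevelSup A v g δ z :=
  sublevelSup_le_iff.1 le_rfl j hj h

theorem sublevelSup_le_sup : sublevelSup A v g δ z ≤ A.sup v :=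
  Finset.sup_mono (Finset.filter_subset _ _)

theorem sublevelSup_le_sublevelSup {Z' : Type*} {g' : ι → Z' → ℝ} {δ' : ℝ} {z' : Z'}
    (hA : A ⊆ A') (h : ∀ j ∈ A, g j z ≤ δ → g' j z' ≤ δ') :
    sublevelSup A v g δ z ≤ sublevelSup A' v g' δ' z' :=
  sublevelSup_le_iff.2 fun j hj hz => le_sublevelSup (hA hj) (h j hj hz)

theorem measurable_sublevelSup [MeasurableSpace Z] (hg : ∀ j, Measurable (g j)) :
    Measurable (sublevelSup A v g δ) := by
  refine measurable_of_Iic fun n => ?_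
  have h_eq : sublevelSup A v g δ ⁻¹' Set.Iic n =
      ⋂ j ∈ A, {z | g j z ≤ δ → v j ≤ n} := by
    ext z
    simp only [Set.mem_preimage, Set.mem_Iic, sublevelSup_le_iff, Set.mem_iInter,
      Set.mem_ofPred_eq]
  rw [h_eq]
  exact Finset.measurableSet_biInter _ fun j _ =>
    (measurableSet_le (hg j) measurable_const).imp (MeasurableSet.const _)

theorem eventually_sublevelSup_eq (z : Z) (δ₀ : ℝ) :
    ∀ᶠ δ in 𝓝[≥] δ₀, sublevelSup A v g δ z = sublevelSup A v g δ₀ z := by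
  have h_iff : ∀ j ∈ A, ∀ᶠ δ in 𝓝[≥] δ₀, (g j z ≤ δ ↔ g j z ≤ δ₀) := by
    intro j _
    rcases le_or_gt (g j z) δ₀ with hj | hj
    · filter_upwards [self_mem_nhdsWithin] with δ hδ using iff_of_true (hj.trans hδ) hj
    · filter_upwards [nhdsWithin_le_nhds (Iio_mem_nhds hj)] with δ hδ using
        iff_of_false (not_le.2 hδ) (not_le.2 hj)
  filter_upwards [(eventually_all_finset A).2 h_iff] with δ hδ
  exact congrArg (Finset.sup · v) (Finset.filter_congr hδ)

theorem tendsto_lintegral_sublevelSup [MeasurableSpace Z] (hg : ∀ j, Measurable (g j))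
    (μ : Measure Z) [IsFiniteMeasure μ] (δ₀ : ℝ) :
    Tendsto (fun δ => ∫⁻ z, sublevelSup A v g δ z ∂μ) (𝓝[≥] δ₀)
      (𝓝 (∫⁻ z, sublevelSup A v g δ₀ z ∂μ)) := by
  refine tendsto_lintegral_filter_of_dominated_convergence (fun _ => ((A.sup v : ℕ) : ℝ≥0∞))
    (Eventually.of_forall fun δ => measurable_from_top.comp (measurable_sublevelSup hg))
    (Eventually.of_forall fun δ => ae_of_all _ fun z => Nat.cast_le.2 sublevelSup_le_sup)
    (by simp [ENNReal.mul_eq_top]) (ae_of_all _ fun z => tendsto_const_nhds.congr' ?_)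
  filter_upwards [eventually_sublevelSup_eq z δ₀] with δ hδ
  rw [hδ]

end SublevelSup

/-- The index of the centre of the ball of the step function with code `m`. -/
def stepCenter (m : ℕ) : ℕ := m.unpair.1.unpair.1

/-- The radius of the ball of the step function with code `m`. -/
noncomputable def stepRadius (m : ℕ) : ℝ := posRatNum m.unpair.1.unpair.2

/-- The numerator of the radius of the ball of the step function with code `m`. -/
def stepRadiusNum (m : ℕ) : ℕ := m.unpair.1.unpair.2.unpair.1 + 1

/-- The denominator of the radius of the ball of the step function with code `m`. -/
def stepRadiusDen (m : ℕ) : ℕ := m.unpair.1.unpair.2.unpair.2 + 1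

/-- The numerator of the value of the step function with code `m`, used as its value where only
steps of integer value matter. -/
def stepValue (m : ℕ) : ℕ := m.unpair.2.unpair.1

/-- An atom is a step function together with a ball of measures on which it is to be used; this is
the index of the ideal measure at the centre of that ball. -/
def atomMeasure (i : ℕ) : ℕ := i.unpair.1.unpair.1

/-- The ball of measures of the atom `i` has radius `2 ^ (-atomExponent i)`. -/
def atomExponent (i : ℕ) : ℕ := i.unpair.1.unpair.2

/-- The code of the step function of an atom. The component `i.unpair.2.unpair.2` of the atom is
free: it makes room for a witness by which a semidecidable set of atoms becomes decidable. -/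
def atomStep (i : ℕ) : ℕ := i.unpair.2.unpair.1

section Primrec

variable {α : Type*} [Primcodable α] {f : α → ℕ}

@[fun_prop]
theorem primrec_stepCenter (hf : Primrec f) : Primrec fun a => stepCenter (f a) := by
  unfold stepCenter; fun_prop

@[fun_prop]
theorem primrec_stepRadiusNum (hf : Primrec f) : Primrec fun a => stepRadiusNum (f a) := by
  unfold stepRadiusNum; fun_prop

@[fun_prop]
theorem primrec_stepRadiusDen (hf : Primrec f) : Primrec fun a => stepRadiusDen (f a) := by
  unfold stepRadiusDen; fun_prop

@[fun_prop]
theorem primrec_stepValue (hf : Primrec f) : Primrec fun a => stepValue (f a) := by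
  unfold stepValue; fun_prop

@[fun_prop]
theorem primrec_atomMeasure (hf : Primrec f) : Primrec fun a => atomMeasure (f a) := by
  unfold atomMeasure; fun_prop

@[fun_prop]
theorem primrec_atomExponent (hf : Primrec f) : Primrec fun a => atomExponent (f a) := by
  unfold atomExponent; fun_prop

@[fun_prop]
theorem primrec_atomStep (hf : Primrec f) : Primrec fun a => atomStep (f a) := by
  unfold atomStep; fun_prop

end Primrec

theorem stepRadiusDen_pos (m : ℕ) : 0 < stepRadiusDen m := Nat.succ_pos _

theorem stepRadius_eq (m : ℕ) : stepRadius m = (stepRadiusNum m : ℝ) / stepRadiusDen m := by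
  simp [stepRadius, posRatNum, stepRadiusNum, stepRadiusDen]

theorem stepValue_atomStep_le (i : ℕ) : stepValue (atomStep i) ≤ i :=
  calc stepValue (atomStep i) ≤ (atomStep i).unpair.2 := Nat.unpair_left_le _
    _ ≤ atomStep i := Nat.unpair_right_le _
    _ ≤ i.unpair.2 := Nat.unpair_left_le _
    _ ≤ i := Nat.unpair_right_le _

section Trimming

variable {X : Type*} [MetricSpace X] [CompleteSpace X] [MeasurableSpace X] [BorelSpace X]
  (S : ComputableMetricSpace X) {P : ℕ → Prop} {i a k : ℕ} {δ ε : ℝ} {x y : X}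
  {μ ν : LevyProkhorov (ProbabilityMeasure X)}

/-- The number by which the two balls of the atom `j` have to be enlarged to contain the measure
`μ` and the point `x`; it is at most `0` if and only if the closed balls contain them. -/
noncomputable def atomGap (j : ℕ) (μ : LevyProkhorov (ProbabilityMeasure X)) (x : X) : ℝ :=
  max (dist (idealMeasure S (atomMeasure j)) μ - (1 / 2) ^ atomExponent j)
    (dist x (S.ideal (stepCenter (atomStep j))) - stepRadius (atomStep j))

open Classical in
/-- The largest value at `x` of the step functions of the atoms up to `i` that satisfy `P`, all
balls being closed and enlarged by `δ`. Closed balls make its integral upper semicontinuous, so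
that a strict upper bound of the integral can be confirmed by a finite computation. -/
noncomputable def partialCap (P : ℕ → Prop) (i : ℕ) (δ : ℝ)
    (μ : LevyProkhorov (ProbabilityMeasure X)) (x : X) : ℕ :=
  sublevelSup {j ∈ Finset.range (i + 1) | P j} (fun j => stepValue (atomStep j))
    (fun j => atomGap S j μ) δ x

variable {S}

theorem atomGap_le_atomGap_add (j : ℕ) (hμ : dist μ ν ≤ ε) (hx : dist x y ≤ ε) :
    atomGap S j μ x ≤ atomGap S j ν y + ε := by
  unfold atomGap
  rw [← max_add_add_right]
  refine max_le_max ?_ ?_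
  · linarith [dist_triangle_right (idealMeasure S (atomMeasure j)) μ ν]
  · linarith [dist_triangle x y (S.ideal (stepCenter (atomStep j)))]

theorem measurable_atomGap (j : ℕ) : Measurable (atomGap S j μ) := by
  unfold atomGap; fun_prop

theorem partialCap_le_iff {v : ℕ} : partialCap S P i δ μ x ≤ v ↔
    ∀ j < i + 1, P j → atomGap S j μ x ≤ δ → stepValue (atomStep j) ≤ v := by
  simp only [partialCap, sublevelSup_le_iff, Finset.mem_filter, Finset.mem_range, and_imp]

theorem stepValue_le_partialCap {j : ℕ} (hj : j ≤ i) (hPj : P j) (hx : atomGap S j μ x ≤ δ) :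
    stepValue (atomStep j) ≤ partialCap S P i δ μ x :=
  partialCap_le_iff.1 le_rfl j (Nat.lt_succ_of_le hj) hPj hx

theorem partialCap_le : partialCap S P i δ μ x ≤ i :=
  partialCap_le_iff.2 fun j hj _ _ => (stepValue_atomStep_le j).trans (Nat.le_of_lt_succ hj)

theorem measurable_partialCap : Measurable (partialCap S P i δ μ) :=
  measurable_sublevelSup fun j => measurable_atomGap j

variable (S) in
theorem lintegral_partialCap_le_of_dist_lt (h : dist μ ν < ε) (P : ℕ → Prop) (i : ℕ) (δ : ℝ) :
    ∫⁻ x, partialCap S P i δ μ x ∂(μ.toMeasure : Measure X) ≤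
      ∫⁻ x, partialCap S P i (δ + ε) ν x ∂(ν.toMeasure : Measure X) + i * ENNReal.ofReal ε := by
  have h_cap : ∀ x y, dist y x < ε →
      (partialCap S P i δ μ x : ℝ) ≤ partialCap S P i (δ + ε) ν y := fun x y hxy =>
    Nat.cast_le.2 <| sublevelSup_le_sublevelSup subset_rfl fun j _ hj => by
      linarith [atomGap_le_atomGap_add (S := S) (μ := ν) (ν := μ) j (dist_comm μ ν ▸ h.le) hxy.le]
  have h_meas : ∀ (δ : ℝ) (μ : LevyProkhorov (ProbabilityMeasure X)),
      Measurable fun x => (partialCap S P i δ μ x : ℝ) := fun δ μ =>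
    measurable_from_top.comp measurable_partialCap
  simpa only [ENNReal.ofReal_natCast, mul_comm (ENNReal.ofReal ε)] using
    lintegral_ofReal_le_of_dist_lt h (h_meas _ _) (h_meas _ _) (fun x => Nat.cast_nonneg _)
      (fun x => Nat.cast_nonneg _) (fun x => Nat.cast_le.2 partialCap_le) h_cap

variable (S) in
/-- The atoms that satisfy `P` and whose ball contains `μ`, provided that the atoms up to them
still have a supremum of integral less than `2`. -/
def trimmed (P : ℕ → Prop) (μ : LevyProkhorov (ProbabilityMeasure X)) : Set ℕ :=
  {i | P i ∧ dist (idealMeasure S (atomMeasure i)) μ < (1 / 2) ^ atomExponent i ∧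
    ∫⁻ x, partialCap S P i 0 μ x ∂(μ.toMeasure : Measure X) < 2}

variable (S) in
/-- A condition on the ideal measure with index `a` which ensures that the atom `i` belongs to
`trimmed S P μ` for all `μ` at distance less than `2 ^ (-k)` from that measure. -/
def TrimCertificate (P : ℕ → Prop) (i a k : ℕ) : Prop :=
  P i ∧ dist (idealMeasure S a) (idealMeasure S (atomMeasure i)) + (1 / 2) ^ k <
      (1 / 2) ^ atomExponent i ∧
    ∫⁻ x, partialCap S P i ((1 / 2) ^ k) (idealMeasure S a) x
        ∂((idealMeasure S a).toMeasure : Measure X) + i * ENNReal.ofReal ((1 / 2) ^ k) < 2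

theorem TrimCertificate.mem_trimmed (h : TrimCertificate S P i a k)
    (hμ : dist (idealMeasure S a) μ < (1 / 2) ^ k) : i ∈ trimmed S P μ := by
  obtain ⟨hPi, h_dist, h_int⟩ := h
  refine ⟨hPi, ?_, ?_⟩
  · linarith [dist_triangle_left (idealMeasure S (atomMeasure i)) μ (idealMeasure S a)]
  · refine lt_of_le_of_lt ?_ h_int
    simpa only [zero_add] using
      lintegral_partialCap_le_of_dist_lt S (dist_comm _ μ ▸ hμ) P i 0

theorem tendsto_lintegral_partialCap_add (P : ℕ → Prop) (i : ℕ)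
    (μ : LevyProkhorov (ProbabilityMeasure X)) :
    Tendsto (fun k : ℕ => ∫⁻ x, partialCap S P i (2 * (1 / 2) ^ k) μ x
        ∂(μ.toMeasure : Measure X) + i * ENNReal.ofReal (2 * (1 / 2) ^ k)) atTop
      (𝓝 (∫⁻ x, partialCap S P i 0 μ x ∂(μ.toMeasure : Measure X))) := by
  have h_cap : Tendsto (fun δ => ∫⁻ x, partialCap S P i δ μ x ∂(μ.toMeasure : Measure X))
      (𝓝[≥] 0) (𝓝 (∫⁻ x, partialCap S P i 0 μ x ∂(μ.toMeasure : Measure X))) :=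
    tendsto_lintegral_sublevelSup measurable_atomGap _ 0
  have h_int := h_cap.comp <| tendsto_nhdsWithin_iff.2
      ⟨tendsto_two_mul_half_pow, Eventually.of_forall fun k => Set.mem_Ici.2 (by positivity)⟩
  have h_err : Tendsto (fun k : ℕ => (i : ℝ≥0∞) * ENNReal.ofReal (2 * (1 / 2) ^ k)) atTop
      (𝓝 (i * ENNReal.ofReal 0)) :=
    ENNReal.Tendsto.const_mul (ENNReal.tendsto_ofReal tendsto_two_mul_half_pow)
      (Or.inr (ENNReal.natCast_ne_top i))
  simpa only [ENNReal.ofReal_zero, mul_zero, add_zero, Function.comp_apply] using h_int.add h_err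

theorem exists_trimCertificate (hi : i ∈ trimmed S P μ) {τ : ℕ → ℕ}
    (hτ : ∀ k, dist (idealMeasure S (τ k)) μ < (1 / 2) ^ k) :
    ∃ k, TrimCertificate S P i (τ k) k := by
  obtain ⟨hPi, h_dist, h_int⟩ := hi
  obtain ⟨k, hk_dist, hk_int⟩ :=
    ((tendsto_two_mul_half_pow.eventually_lt_const (sub_pos.2 h_dist)).and
      ((tendsto_lintegral_partialCap_add P i μ).eventually_lt_const h_int)).exists
  refine ⟨k, hPi, ?_, ?_⟩
  · linarith [hτ k,
      dist_triangle_right (idealMeasure S (τ k)) (idealMeasure S (atomMeasure i)) μ]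
  · have h_stable := lintegral_partialCap_le_of_dist_lt S (hτ k) P i ((1 / 2) ^ k)
    rw [← two_mul] at h_stable
    refine lt_of_le_of_lt (add_le_add_left h_stable _) ?_
    rwa [add_assoc, ← mul_add, ← ENNReal.ofReal_add (by positivity) (by positivity), ← two_mul]

end Trimming

section ValueSum

variable {α : Type*} [Primcodable α]

/-- The sum of the last components of a list of triples (index, weight, value), each multiplied by
its weight, which is off by one as in `weightedSum`. -/
def valueSum (L : List ((ℕ × ℕ) × ℕ)) : ℕ := (L.map fun e => (e.1.2 + 1) * e.2).sum

@[fun_prop]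
theorem primrec_valueSum {f : α → List ((ℕ × ℕ) × ℕ)} (hf : Primrec f) :
    Primrec fun a => valueSum (f a) := by
  refine (Primrec.list_foldr (h := fun (_ : α) (x : ((ℕ × ℕ) × ℕ) × ℕ) =>
    (x.1.1.2 + 1) * x.1.2 + x.2) hf (Primrec.const 0) ?_).of_eq fun a => ?_
  · change Primrec fun y : α × ((ℕ × ℕ) × ℕ) × ℕ => (y.2.1.1.2 + 1) * y.2.1.2 + y.2.2
    fun_prop
  · unfold valueSum
    induction f a with
    | nil => rfl
    | cons b l ih => simp only [List.foldr_cons, ih, List.map_cons, List.sum_cons]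

theorem valueSum_map_le {f : ℕ → ℕ} {L : List ((ℕ × ℕ) × ℕ)} (hL : ∀ e ∈ L, f e.1.1 ≤ e.2) :
    valueSum ((L.map Prod.fst).map fun e => (e, f e.1)) ≤ valueSum L := by
  rw [List.map_map, valueSum, List.map_map]
  exact List.sum_le_sum fun e he => Nat.mul_le_mul_left _ (hL e he)

theorem rePred_mul_valueSum_add_lt {f : α → ℕ → ℕ} {l : α → List (ℕ × ℕ)} {p q r : α → ℕ}
    (hf : REPred fun x : (α × ℕ) × ℕ => f x.1.1 x.1.2 ≤ x.2) (hl : Primrec l) (hp : Primrec p)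
    (hq : Primrec q) (hr : Primrec r) :
    REPred fun a => p a * valueSum ((l a).map fun e => (e, f a e.1)) + q a < r a := by
  have h_bound : REPred fun x : (α × List ((ℕ × ℕ) × ℕ)) × ((ℕ × ℕ) × ℕ) =>
      f x.1.1 x.2.1.1 ≤ x.2.2 :=
    rePred_comp (f := fun x : (α × List ((ℕ × ℕ) × ℕ)) × ((ℕ × ℕ) × ℕ) =>
      ((x.1.1, x.2.1.1), x.2.2)) hf (by fun_prop)
  have h_fst : Primrec fun x : α × List ((ℕ × ℕ) × ℕ) => x.2.map Prod.fst :=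
    Primrec.list_map Primrec.snd (Primrec.fst.comp Primrec.snd)
  refine (rePred_exists (p := fun (a : α) (L : List ((ℕ × ℕ) × ℕ)) => L.map Prod.fst = l a ∧
    (∀ e ∈ L, f a e.1.1 ≤ e.2) ∧ p a * valueSum L + q a < r a)
    (rePred_and (rePred_eq h_fst (by fun_prop)) (rePred_and
      (rePred_forall_mem h_bound (by fun_prop)) (rePred_lt (by fun_prop) (by fun_prop))))).of_eq
    fun a => ⟨?_, fun h => ⟨_, ?_, ?_, h⟩⟩
  · rintro ⟨L, hL, hfL, h⟩
    rw [← hL]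
    refine lt_of_le_of_lt ?_ h
    gcongr
    exact valueSum_map_le hfL
  · rw [List.map_map]
    exact List.map_id _
  · simp only [List.mem_map]
    rintro _ ⟨e, -, rfl⟩
    exact le_rfl

theorem inv_mul_add_lt_two_iff {B i k t : ℕ} (ht : 0 < t) :
    (t : ℝ≥0∞)⁻¹ * B + i * ENNReal.ofReal ((1 / 2) ^ k) < 2 ↔
      2 ^ k * B + i * t < 2 * 2 ^ k * t := by
  have ht' : (0 : ℝ) < t := by exact_mod_cast ht
  have h_ofReal : (t : ℝ≥0∞)⁻¹ * B + i * ENNReal.ofReal ((1 / 2) ^ k) =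
      ENNReal.ofReal (((2 ^ k * B + i * t : ℕ) : ℝ) / (2 ^ k * t)) := by
    rw [show (((2 ^ k * B + i * t : ℕ) : ℝ) / (2 ^ k * t)) = (t : ℝ)⁻¹ * B + i * (1 / 2) ^ k by
        rw [one_div, inv_pow]; push_cast; field_simp,
      ENNReal.ofReal_add (by positivity) (by positivity), ENNReal.ofReal_mul (by positivity),
      ENNReal.ofReal_mul (by positivity), ENNReal.ofReal_inv_of_pos ht']
    simp only [ENNReal.ofReal_natCast]
  rw [h_ofReal, show (2 : ℝ≥0∞) = ENNReal.ofReal 2 by simp,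
    ENNReal.ofReal_lt_ofReal_iff (by norm_num), div_lt_iff₀ (by positivity), ← mul_assoc]
  exact_mod_cast Iff.rfl

end ValueSum

section HalfPow

variable (d : ℝ) (k l m : ℕ)

theorem half_pow_eq_div : (1 / 2 : ℝ) ^ l = 2 ^ k / 2 ^ (k + l) := by
  rw [one_div, inv_pow, pow_add]
  field_simp

theorem add_half_pow_lt_half_pow_iff (hd : 0 ≤ d) :
    d + (1 / 2) ^ k < (1 / 2) ^ l ↔ d < (2 ^ k - 2 ^ l : ℕ) / (2 ^ (k + l) : ℕ) := by
  rw [← lt_sub_iff_add_lt, half_pow_eq_div k l, half_pow_eq_div l k, add_comm l k, ← sub_div]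
  rcases le_total (2 ^ l) (2 ^ k) with h | h
  · push_cast [h]
    rfl
  · have h' : (2 : ℝ) ^ k - 2 ^ l ≤ 0 := sub_nonpos.2 (by exact_mod_cast h)
    rw [Nat.sub_eq_zero_of_le h, Nat.cast_zero, zero_div]
    exact iff_of_false (not_lt.2 ((div_nonpos_of_nonpos_of_nonneg h' (by positivity)).trans hd))
      hd.not_gt

theorem half_pow_lt_sub_half_pow_iff :
    (1 / 2) ^ k < d - (1 / 2) ^ l ↔ (2 ^ k + 2 ^ l : ℕ) / (2 ^ (k + l) : ℕ) < d := by
  rw [lt_sub_iff_add_lt', half_pow_eq_div k l, half_pow_eq_div l k, add_comm l k, ← add_div]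
  push_cast
  rfl

theorem half_pow_lt_sub_stepRadius_iff : (1 / 2) ^ k < d - stepRadius m ↔
    (stepRadiusNum m * 2 ^ k + stepRadiusDen m : ℕ) / (stepRadiusDen m * 2 ^ k : ℕ) < d := by
  have h_den : (stepRadiusDen m : ℝ) ≠ 0 := by exact_mod_cast (stepRadiusDen_pos m).ne'
  rw [lt_sub_iff_add_lt', stepRadius_eq, one_div, inv_pow]
  push_cast
  rw [add_div, mul_div_mul_right _ _ (by positivity), ← div_div, div_self h_den, one_div]

end HalfPow

section TrimCertificate

variable {X : Type*} [MetricSpace X] [CompleteSpace X] [MeasurableSpace X]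
  (S : ComputableMetricSpace X) {α : Type*} [Primcodable α]

theorem lintegral_natCast_idealMeasure (a : ℕ) {f : X → ℕ} (hf : Measurable f) :
    ∫⁻ x, f x ∂((idealMeasure S a).toMeasure : Measure X) =
      (totalWeight (weightList a) : ℝ≥0∞)⁻¹ *
        valueSum ((weightList a).map fun e => (e, f (S.ideal e.1))) := by
  have hf' : Measurable fun x => (f x : ℝ≥0∞) := measurable_from_top.comp hf
  rw [idealMeasure_eq_smul, lintegral_smul_measure,
    lintegral_weightedSum _ _ hf', smul_eq_mul, valueSum, List.map_map,
    Nat.cast_list_sum, List.map_map]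
  congr 3
  ext e
  simp

variable [BorelSpace X]

theorem rePred_lt_atomGap {j a k n : α → ℕ} (hj : Primrec j) (ha : Primrec a) (hk : Primrec k)
    (hn : Primrec n) : REPred fun x =>
      (1 / 2) ^ k x < atomGap S (j x) (idealMeasure S (a x)) (S.ideal (n x)) := by
  have h_measure : REPred fun x =>
      ((2 ^ k x + 2 ^ atomExponent (j x) : ℕ) / (2 ^ (k x + atomExponent (j x)) : ℕ) : ℝ) <
        dist (idealMeasure S (atomMeasure (j x))) (idealMeasure S (a x)) :=
    (isLowerSemicomputable_dist_idealMeasure S).rePred_div_lt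
      (g := fun x => (atomMeasure (j x), a x)) (by fun_prop) (by fun_prop) (by fun_prop)
      fun x => by positivity
  have h_point : REPred fun x =>
      ((stepRadiusNum (atomStep (j x)) * 2 ^ k x + stepRadiusDen (atomStep (j x)) : ℕ) /
        (stepRadiusDen (atomStep (j x)) * 2 ^ k x : ℕ) : ℝ) <
        dist (S.ideal (n x)) (S.ideal (stepCenter (atomStep (j x)))) :=
    (isLowerSemicomputable_dist_ideal S).rePred_div_lt
      (g := fun x => (n x, stepCenter (atomStep (j x)))) (by fun_prop) (by fun_prop) (by fun_prop)
      fun x => Nat.mul_pos (stepRadiusDen_pos _) (by positivity)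
  refine (rePred_or h_measure h_point).of_eq fun x => ?_
  rw [atomGap, lt_max_iff, half_pow_lt_sub_half_pow_iff, half_pow_lt_sub_stepRadius_iff]

theorem rePred_partialCap_le {P : ℕ → ℕ → Prop} (hP : PrimrecPred fun x : ℕ × ℕ => P x.1 x.2)
    {c i k a n v : α → ℕ} (hc : Primrec c) (hi : Primrec i) (hk : Primrec k) (ha : Primrec a)
    (hn : Primrec n) (hv : Primrec v) : REPred fun x => partialCap S (P (c x)) (i x)
      ((1 / 2) ^ k x) (idealMeasure S (a x)) (S.ideal (n x)) ≤ v x := by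
  have h_not : REPred fun y : α × ℕ => ¬ P (c y.1) y.2 :=
    rePred_of_primrecPred (hP.not.comp (f := fun y : α × ℕ => (c y.1, y.2)) (by fun_prop))
  have h_gap : REPred fun y : α × ℕ =>
      (1 / 2) ^ k y.1 < atomGap S y.2 (idealMeasure S (a y.1)) (S.ideal (n y.1)) :=
    rePred_lt_atomGap S (by fun_prop) (by fun_prop) (by fun_prop) (by fun_prop)
  have h_value : REPred fun y : α × ℕ => stepValue (atomStep y.2) ≤ v y.1 :=
    rePred_le (by fun_prop) (by fun_prop)
  refine (rePred_forall_lt (p := fun x j => ¬ P (c x) j ∨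
    (1 / 2) ^ k x < atomGap S j (idealMeasure S (a x)) (S.ideal (n x)) ∨
      stepValue (atomStep j) ≤ v x) (f := fun x => i x + 1)
    (rePred_or h_not (rePred_or h_gap h_value)) (by fun_prop)).of_eq fun x => ?_
  simp only [partialCap_le_iff, ← not_lt (a := (1 / 2 : ℝ) ^ k x), imp_iff_not_or, not_not]

theorem rePred_dist_add_half_pow_lt {a b k l : α → ℕ} (ha : Primrec a) (hb : Primrec b)
    (hk : Primrec k) (hl : Primrec l) : REPred fun x =>
      dist (idealMeasure S (a x)) (idealMeasure S (b x)) + (1 / 2) ^ k x < (1 / 2) ^ l x := by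
  have h : REPred fun x => dist (idealMeasure S (a x)) (idealMeasure S (b x)) <
      (2 ^ k x - 2 ^ l x : ℕ) / (2 ^ (k x + l x) : ℕ) :=
    (isUpperSemicomputable_dist_idealMeasure S).rePred_lt_div (g := fun x => (a x, b x))
      (by fun_prop) (by fun_prop) (by fun_prop) fun x => by positivity
  exact h.of_eq fun x => (add_half_pow_lt_half_pow_iff _ _ _ dist_nonneg).symm

theorem rePred_lintegral_partialCap_add_lt_two {P : ℕ → ℕ → Prop}
    (hP : PrimrecPred fun x : ℕ × ℕ => P x.1 x.2) {c i k a : α → ℕ} (hc : Primrec c)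
    (hi : Primrec i) (hk : Primrec k) (ha : Primrec a) : REPred fun x =>
      ∫⁻ y, partialCap S (P (c x)) (i x) ((1 / 2) ^ k x) (idealMeasure S (a x)) y
        ∂((idealMeasure S (a x)).toMeasure : Measure X) +
          i x * ENNReal.ofReal ((1 / 2) ^ k x) < 2 := by
  refine (rePred_mul_valueSum_add_lt (f := fun x n => partialCap S (P (c x)) (i x)
    ((1 / 2) ^ k x) (idealMeasure S (a x)) (S.ideal n)) (l := fun x => weightList (a x))
    (p := fun x => 2 ^ k x) (q := fun x => i x * totalWeight (weightList (a x)))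
    (r := fun x => 2 * 2 ^ k x * totalWeight (weightList (a x)))
    (rePred_partialCap_le S hP (by fun_prop) (by fun_prop) (by fun_prop) (by fun_prop)
      (by fun_prop) (by fun_prop)) (by fun_prop) (by fun_prop) (by fun_prop)
    (by fun_prop)).of_eq fun x => ?_
  rw [lintegral_natCast_idealMeasure S _ measurable_partialCap,
    inv_mul_add_lt_two_iff (totalWeight_weightList_pos _)]

theorem rePred_trimCertificate {P : ℕ → ℕ → Prop} (hP : PrimrecPred fun x : ℕ × ℕ => P x.1 x.2)
    {c i a k : α → ℕ} (hc : Primrec c) (hi : Primrec i) (ha : Primrec a) (hk : Primrec k) :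
    REPred fun x => TrimCertificate S (P (c x)) (i x) (a x) (k x) := by
  have h_mem : REPred fun x => P (c x) (i x) :=
    rePred_of_primrecPred (hP.comp (f := fun x => (c x, i x)) (by fun_prop))
  exact rePred_and h_mem (rePred_and
    (rePred_dist_add_half_pow_lt S (by fun_prop) (by fun_prop) hk (by fun_prop))
    (rePred_lintegral_partialCap_add_lt_two S hP hc hi hk ha))

end TrimCertificate

section Steps

/-- The denominator of the value of the step function with code `m`. -/
def stepValueDen (m : ℕ) : ℕ := m.unpair.2.unpair.2 + 1

@[fun_prop]
theorem primrec_stepValueDen {α : Type*} [Primcodable α] {f : α → ℕ} (hf : Primrec f) :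
    Primrec fun a => stepValueDen (f a) := by
  unfold stepValueDen; fun_prop

theorem nnRatNum_unpair_snd (n : ℕ) :
    (nnRatNum n.unpair.2 : ℝ≥0∞) = stepValue n / stepValueDen n := by
  rw [nnRatNum, stepValue, stepValueDen, ENNReal.coe_div (by positivity)]
  push_cast
  rfl

/-- The ball of the step function `m` is concentric with and formally smaller than that of the step
function `n`, and the natural number `stepValue m` is at most the value of `n`. -/
def StepRefines (m n : ℕ) : Prop :=
  stepCenter m = stepCenter n ∧
    stepRadiusNum m * stepRadiusDen n < stepRadiusNum n * stepRadiusDen m ∧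
    stepValue m * stepValueDen n ≤ stepValue n

/-- The code of the step function `m` with value `stepValue m / 2 ^ (c + 3)`. -/
def scaleStep (c m : ℕ) : ℕ := Nat.pair m.unpair.1 (Nat.pair (stepValue m) (2 ^ (c + 3) - 1))

theorem StepRefines.stepRadius_lt {m n : ℕ} (h : StepRefines m n) :
    stepRadius m < stepRadius n := by
  rw [stepRadius_eq, stepRadius_eq, div_lt_div_iff₀ (by exact_mod_cast stepRadiusDen_pos m)
    (by exact_mod_cast stepRadiusDen_pos n)]
  exact_mod_cast h.2.1

theorem StepRefines.stepValue_le {m n : ℕ} (h : StepRefines m n) :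
    (stepValue m : ℝ≥0∞) ≤ nnRatNum n.unpair.2 := by
  rw [nnRatNum_unpair_snd,
    ENNReal.le_div_iff_mul_le (by simp [stepValueDen]) (by simp)]
  exact_mod_cast h.2.2

theorem exists_stepRefines {n : ℕ} {r : ℝ} (h_nonneg : 0 ≤ r) (hr : r < stepRadius n) :
    ∃ m, StepRefines m n ∧ r < stepRadius m ∧
      (nnRatNum n.unpair.2 : ℝ≥0∞) ≤ stepValue m + 1 := by
  obtain ⟨p, q, hrp, hpn⟩ := exists_nat_div_btwn h_nonneg hr
  have hp : p - 1 + 1 = p := Nat.sub_add_cancel <| Nat.pos_of_ne_zero <| by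
    rintro rfl
    simp [h_nonneg.not_gt] at hrp
  let m := Nat.pair (Nat.pair (stepCenter n) (Nat.pair (p - 1) q))
    (Nat.pair (stepValue n / stepValueDen n) 0)
  have h_num : stepRadiusNum m = p := by simp [stepRadiusNum, m, hp]
  have h_den : stepRadiusDen m = q + 1 := by simp [stepRadiusDen, m]
  have h_value : stepValue m = stepValue n / stepValueDen n := by simp [stepValue, m]
  refine ⟨m, ⟨by simp [stepCenter, m], ?_, ?_⟩, ?_, ?_⟩
  · rw [stepRadius_eq,
      div_lt_div_iff₀ (by positivity) (by exact_mod_cast stepRadiusDen_pos n)] at hpn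
    rw [h_num, h_den]
    exact_mod_cast hpn
  · rw [h_value]
    exact Nat.div_mul_le_self _ _
  · rw [stepRadius_eq, h_num, h_den]
    exact_mod_cast hrp
  · rw [nnRatNum_unpair_snd, ENNReal.div_le_iff (by simp [stepValueDen]) (by simp), h_value,
      mul_comm]
    exact_mod_cast (Nat.lt_mul_div_succ (stepValue n) (Nat.succ_pos _)).le

variable {X : Type*} [MetricSpace X] [CompleteSpace X] (S : ComputableMetricSpace X)

theorem stepFun_apply (n : ℕ) (x : X) : stepFun S ennrealLattice n x =
    if dist x (S.ideal (stepCenter n)) < stepRadius n then (nnRatNum n.unpair.2 : ℝ≥0∞) else 0 := by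
  classical exact if_congr Iff.rfl rfl rfl

theorem stepFun_scaleStep (c m : ℕ) (x : X) : stepFun S ennrealLattice (scaleStep c m) x =
    if dist x (S.ideal (stepCenter m)) < stepRadius m
      then (2⁻¹ : ℝ≥0∞) ^ (c + 3) * stepValue m else 0 := by
  have h_center : stepCenter (scaleStep c m) = stepCenter m := by simp [stepCenter, scaleStep]
  have h_radius : stepRadius (scaleStep c m) = stepRadius m := by simp [stepRadius, scaleStep]
  have h_num : stepValue (scaleStep c m) = stepValue m := by simp [stepValue, scaleStep]
  have h_den : stepValueDen (scaleStep c m) = 2 ^ (c + 3) := by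
    simp [stepValueDen, scaleStep, Nat.sub_add_cancel Nat.one_le_two_pow]
  rw [stepFun_apply, nnRatNum_unpair_snd, h_center, h_radius, h_num, h_den, mul_comm,
    div_eq_mul_inv, ← ENNReal.inv_pow]
  push_cast
  rfl

theorem describes_iff (E : Set ℕ) (f : LowerFun S ennrealLattice) :
    (LowerFun.enumerativeLattice S ennrealLattice).Describes E f ↔
      ∀ x, f x = ⨆ n ∈ E, stepFun S ennrealLattice n x := by
  have h_coe : (⨆ n ∈ E, (LowerFun.enumerativeLattice S ennrealLattice).elem n).1 =
      ⨆ n ∈ E, stepFun S ennrealLattice n := by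
    simp only [LowerFun.coe_iSup]
    rfl
  refine Subtype.ext_iff.trans ?_
  rw [h_coe, funext_iff]
  simp only [iSup_apply]

end Steps

section Lists

/-- The partial recursive function with code `c` maps the finite sequence `u` to a finite sequence
with the term `n`. -/
def Lists (c : ℕ) (u : List ℕ) (n : ℕ) : Prop :=
  ∃ v : List ℕ, Encodable.encode v ∈
    (Denumerable.ofNat Nat.Partrec.Code c).eval (Encodable.encode u) ∧ n ∈ v

theorem rePred_lists : REPred fun x : ℕ × List ℕ × ℕ => Lists x.1 x.2.1 x.2.2 := by
  have h_eval : Partrec fun x : ℕ × List ℕ =>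
      (Denumerable.ofNat Nat.Partrec.Code x.1).eval (Encodable.encode x.2) :=
    Nat.Partrec.Code.eval_part.comp ((Computable.ofNat _).comp Computable.fst)
      (Computable.encode.comp Computable.snd)
  have h_mem : REPred fun x : (ℕ × List ℕ × ℕ) × List ℕ => Encodable.encode x.2 ∈
      (Denumerable.ofNat Nat.Partrec.Code x.1.1).eval (Encodable.encode x.1.2.1) :=
    rePred_comp (f := fun x : (ℕ × List ℕ × ℕ) × List ℕ =>
      ((x.1.1, x.1.2.1), Encodable.encode x.2)) (rePred_mem_of_partrec h_eval)
      (by have := @Primrec.encode (List ℕ) _; fun_prop)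
  have h_term : REPred fun x : (ℕ × List ℕ × ℕ) × List ℕ => x.1.2.2 ∈ x.2 :=
    (rePred_exists_mem (p := fun (x : (ℕ × List ℕ × ℕ) × List ℕ) n => n = x.1.2.2)
      (l := fun x => x.2) (rePred_eq (by fun_prop) (by fun_prop)) (by fun_prop)).of_eq
      fun x => by simp
  exact rePred_exists (rePred_and h_mem h_term)

theorem exists_lists_iff {F : List ℕ → List ℕ} (hF : Computable F) :
    ∃ c, ∀ u n, Lists c u n ↔ n ∈ F u := by
  obtain ⟨code, h_code⟩ := Nat.Partrec.Code.exists_code.1 hF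
  refine ⟨Encodable.encode code, fun u n => ?_⟩
  simp [Lists, h_code]

end Lists

section Produces

variable {X : Type*} [MetricSpace X] [CompleteSpace X] [MeasurableSpace X] [BorelSpace X]
  (S : ComputableMetricSpace X)

/-- The partial recursive function with code `c`, applied to some prefix of a name of length `l`
and with last term `b`, lists a step function which is refined by `m`. -/
def Produces (c b l m : ℕ) : Prop :=
  ∃ u : List ℕ, ∃ n, l = u.length + 1 ∧ IsNamePrefix (idealMeasure S) (u ++ [b]) ∧
    Lists c (u ++ [b]) n ∧ StepRefines m n

theorem rePred_isNamePrefix : REPred (IsNamePrefix (idealMeasure S)) := by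
  have h_half : ∀ j : ℕ, (1 / 2 : ℝ) ^ j = (1 : ℕ) / (2 ^ j : ℕ) := fun j => by
    rw [one_div_pow, Nat.cast_one, Nat.cast_pow, Nat.cast_ofNat]
  have h_dist : REPred fun x : List ℕ × ℕ => dist (idealMeasure S (x.1.getD x.2 0))
      (idealMeasure S (x.1.getD (x.2 + 1) 0)) < (1 / 2 : ℝ) ^ x.2 := by
    simp only [h_half]
    exact (isUpperSemicomputable_dist_idealMeasure S).rePred_lt_div
      (g := fun x : List ℕ × ℕ => (x.1.getD x.2 0, x.1.getD (x.2 + 1) 0)) (num := fun _ => 1)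
      (den := fun x => 2 ^ x.2) (by fun_prop) (by fun_prop) (by fun_prop) fun x => by positivity
  exact rePred_forall_lt (p := fun (u : List ℕ) (j : ℕ) => dist (idealMeasure S (u.getD j 0))
    (idealMeasure S (u.getD (j + 1) 0)) < (1 / 2 : ℝ) ^ j) h_dist (by fun_prop)

theorem rePred_produces :
    REPred fun x : ℕ × ℕ × ℕ × ℕ => Produces S x.1 x.2.1 x.2.2.1 x.2.2.2 := by
  have h_prefix := rePred_comp (f := fun x : ((ℕ × ℕ × ℕ × ℕ) × List ℕ) × ℕ =>
    x.1.2 ++ [x.1.1.2.1]) (rePred_isNamePrefix S) (by fun_prop)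
  have h_lists := rePred_comp (f := fun x : ((ℕ × ℕ × ℕ × ℕ) × List ℕ) × ℕ =>
    (x.1.1.1, x.1.2 ++ [x.1.1.2.1], x.2)) rePred_lists (by fun_prop)
  have h_refines : REPred fun x : ((ℕ × ℕ × ℕ × ℕ) × List ℕ) × ℕ =>
      StepRefines x.1.1.2.2.2 x.2 :=
    rePred_and (rePred_eq (by fun_prop) (by fun_prop)) (rePred_and
      (rePred_lt (by fun_prop) (by fun_prop)) (rePred_le (by fun_prop) (by fun_prop)))
  have h_length : REPred fun x : ((ℕ × ℕ × ℕ × ℕ) × List ℕ) × ℕ =>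
      x.1.1.2.2.1 = x.1.2.length + 1 :=
    rePred_eq (by fun_prop) (by fun_prop)
  exact rePred_exists (rePred_exists (rePred_and h_length (rePred_and h_prefix
    (rePred_and h_lists h_refines))))

/-- The numbers that satisfy `P c` are codes of exactly the atoms which the partial recursive
function with code `c` produces. -/
def IsAtomEnumeration (P : ℕ → ℕ → Prop) : Prop :=
  ∀ c b l m, Produces S c b l m ↔
    ∃ i, P c i ∧ atomMeasure i = b ∧ atomExponent i = l ∧ atomStep i = m

theorem exists_isAtomEnumeration : ∃ P : ℕ → ℕ → Prop,
    PrimrecPred (fun x : ℕ × ℕ => P x.1 x.2) ∧ IsAtomEnumeration S P := by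
  obtain ⟨r, hr, h⟩ := rePred_iff_exists_primrecPred.1 (rePred_produces S)
  refine ⟨fun c i => r ((c, atomMeasure i, atomExponent i, atomStep i), i.unpair.2.unpair.2),
    hr.comp (by fun_prop), fun c b l m => (h (c, b, l, m)).trans ⟨?_, ?_⟩⟩
  · rintro ⟨t, ht⟩
    refine ⟨Nat.pair (Nat.pair b l) (Nat.pair m t), ?_⟩
    simpa [atomMeasure, atomExponent, atomStep] using ht
  · rintro ⟨i, hi, rfl, rfl, rfl⟩
    exact ⟨_, hi⟩

end Produces

section UniversalTest

variable {X : Type*} [MetricSpace X] [CompleteSpace X] [MeasurableSpace X] [BorelSpace X]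
  (S : ComputableMetricSpace X) (P : ℕ → ℕ → Prop)
  {μ : LevyProkhorov (ProbabilityMeasure X)} {x : X} {c i : ℕ}

/-- The codes of the step functions whose supremum is the universal test: the constants `1 / 2` on
balls, and for all `c` the trimmed atoms that satisfy `P c`, with values divided by `2 ^ (c + 3)`.
The constants absorb the error made by rounding down the values of a test to natural numbers. -/
def universalCodes (μ : LevyProkhorov (ProbabilityMeasure X)) : Set ℕ :=
  {m | m.unpair.2 = Nat.pair 1 1} ∪
    {m | ∃ c, ∃ i ∈ trimmed S (P c) μ, m = scaleStep c (atomStep i)}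

/-- The universal test, for a suitable enumeration `P` of atoms. -/
noncomputable def universalTest (μ : LevyProkhorov (ProbabilityMeasure X)) :
    LowerFun S ennrealLattice :=
  ⟨⨆ n ∈ universalCodes S P μ, stepFun S ennrealLattice n, universalCodes S P μ, rfl⟩

theorem universalTest_apply (μ : LevyProkhorov (ProbabilityMeasure X)) (x : X) :
    universalTest S P μ x = ⨆ n ∈ universalCodes S P μ, stepFun S ennrealLattice n x := by
  change (⨆ n ∈ universalCodes S P μ, stepFun S ennrealLattice n) x = _
  simp only [iSup_apply]

/-- A condition on a prefix `u` of a name of a measure which ensures that `m` is one of the codes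
of the universal test for that measure. -/
def UniversalCertificate (u : List ℕ) (m : ℕ) : Prop :=
  m.unpair.2 = Nat.pair 1 1 ∨ ∃ c i k, k + 1 < u.length ∧ m = scaleStep c (atomStep i) ∧
    TrimCertificate S (P c) i (u.getD (k + 1) 0) k

variable {S P}

theorem rePred_universalCertificate (hP : PrimrecPred fun x : ℕ × ℕ => P x.1 x.2) :
    REPred fun x : List ℕ × ℕ => UniversalCertificate S P x.1 x.2 := by
  have h_length : REPred fun x : (((List ℕ × ℕ) × ℕ) × ℕ) × ℕ => x.2 + 1 < x.1.1.1.1.length :=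
    rePred_lt (by fun_prop) (by fun_prop)
  have h_step : REPred fun x : (((List ℕ × ℕ) × ℕ) × ℕ) × ℕ =>
      x.1.1.1.2 = scaleStep x.1.1.2 (atomStep x.1.2) := by
    unfold scaleStep
    exact rePred_eq (by fun_prop) (by fun_prop)
  have h_cert : REPred fun x : (((List ℕ × ℕ) × ℕ) × ℕ) × ℕ =>
      TrimCertificate S (P x.1.1.2) x.1.2 (x.1.1.1.1.getD (x.2 + 1) 0) x.2 :=
    rePred_trimCertificate S hP (by fun_prop) (by fun_prop) (by fun_prop) (by fun_prop)
  exact rePred_or (rePred_eq (by fun_prop) (by fun_prop))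
    (rePred_exists (rePred_exists (rePred_exists (rePred_and h_length (rePred_and h_step h_cert)))))

theorem exists_universalCertificate_iff {σ : ℕ → ℕ} (hσ : IsCauchyName (idealMeasure S) σ μ)
    (m : ℕ) : (∃ K, UniversalCertificate S P ((List.range K).map σ) m) ↔
      m ∈ universalCodes S P μ := by
  have h_dist : ∀ k, dist (idealMeasure S (σ (k + 1))) μ < (1 / 2) ^ k := fun k => by
    have h_lt := hσ.dist_lt (k + 1)
    rw [pow_succ] at h_lt
    linarith
  have h_getD : ∀ {K k}, k + 1 < K → ((List.range K).map σ).getD (k + 1) 0 = σ (k + 1) :=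
    fun h => by simp [h]
  constructor
  · rintro ⟨K, hm | ⟨c, i, k, hk, rfl, h_cert⟩⟩
    · exact Or.inl hm
    · rw [List.length_map, List.length_range] at hk
      rw [h_getD hk] at h_cert
      exact Or.inr ⟨c, i, h_cert.mem_trimmed (h_dist k), rfl⟩
  · rintro (hm | ⟨c, i, hi, rfl⟩)
    · exact ⟨0, Or.inl hm⟩
    · obtain ⟨k, h_cert⟩ := exists_trimCertificate hi h_dist
      refine ⟨k + 2, Or.inr ⟨c, i, k, by simp, rfl, ?_⟩⟩
      rwa [h_getD (Nat.lt_succ_self _)]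

theorem isConstructive_universalTest (hP : PrimrecPred fun x : ℕ × ℕ => P x.1 x.2) :
    IsConstructive (idealMeasure S) (LowerFun.enumerativeLattice S ennrealLattice)
      (universalTest S P) := by
  obtain ⟨F, hF, h_output⟩ := exists_isRecursiveOperator (rePred_universalCertificate (S := S) hP)
  refine ⟨F, hF, fun μ σ hσ => (describes_iff S _ _).2 fun x => ?_⟩
  have h_codes : operatorOutput F σ = universalCodes S P μ := by
    rw [h_output]
    exact Set.ext (exists_universalCertificate_iff hσ)
  rw [h_codes, universalTest_apply]

theorem half_le_universalTest : 2⁻¹ ≤ universalTest S P μ x := by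
  obtain ⟨n, hn⟩ := S.dense.exists_dist_lt x one_pos
  rw [universalTest_apply]
  refine le_iSup₂_of_le (Nat.pair (Nat.pair n (Nat.pair 0 0)) (Nat.pair 1 1))
    (Or.inl (by simp)) ?_
  rw [stepFun_apply, if_pos (by simpa [stepCenter, stepRadius, posRatNum] using hn),
    nnRatNum_unpair_snd]
  simp [stepValue, stepValueDen, one_add_one_eq_two]

theorem mul_stepValue_le_universalTest (hi : i ∈ trimmed S (P c) μ)
    (hx : dist x (S.ideal (stepCenter (atomStep i))) < stepRadius (atomStep i)) :
    (2⁻¹ : ℝ≥0∞) ^ (c + 3) * stepValue (atomStep i) ≤ universalTest S P μ x := by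
  rw [universalTest_apply]
  refine le_iSup₂_of_le (scaleStep c (atomStep i)) (Or.inr ⟨c, i, hi, rfl⟩) ?_
  rw [stepFun_scaleStep, if_pos hx]

end UniversalTest

section Integral

variable {X : Type*} [MetricSpace X] [CompleteSpace X] [MeasurableSpace X] [BorelSpace X]
  {S : ComputableMetricSpace X} {μ : LevyProkhorov (ProbabilityMeasure X)} {x : X} {i : ℕ}

theorem atomGap_nonpos_iff {j : ℕ} : atomGap S j μ x ≤ 0 ↔
    dist (idealMeasure S (atomMeasure j)) μ ≤ (1 / 2) ^ atomExponent j ∧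
      dist x (S.ideal (stepCenter (atomStep j))) ≤ stepRadius (atomStep j) := by
  rw [atomGap, max_le_iff, sub_nonpos, sub_nonpos]

variable (S) in
/-- The supremum of the trimmed atoms that satisfy `P`, with closed balls. -/
noncomputable def trimmedSup (P : ℕ → Prop) (μ : LevyProkhorov (ProbabilityMeasure X)) (x : X) :
    ℝ≥0∞ :=
  ⨆ i : {i // ∫⁻ x, partialCap S P i 0 μ x ∂(μ.toMeasure : Measure X) < 2}, partialCap S P i 0 μ x

theorem measurable_trimmedSup (P : ℕ → Prop) (μ : LevyProkhorov (ProbabilityMeasure X)) :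
    Measurable (trimmedSup S P μ) :=
  Measurable.iSup fun _ => measurable_from_top.comp measurable_partialCap

theorem lintegral_trimmedSup_le_two (P : ℕ → Prop) (μ : LevyProkhorov (ProbabilityMeasure X)) :
    ∫⁻ x, trimmedSup S P μ x ∂(μ.toMeasure : Measure X) ≤ 2 := by
  have h_meas : ∀ i, Measurable fun x => (partialCap S P i 0 μ x : ℝ≥0∞) := fun _ =>
    measurable_from_top.comp measurable_partialCap
  have h_mono : Monotone fun i x => (partialCap S P i 0 μ x : ℝ≥0∞) := fun i i' hi x =>
    Nat.cast_le.2 <| partialCap_le_iff.2 fun j hj =>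
      stepValue_le_partialCap ((Nat.le_of_lt_succ hj).trans hi)
  unfold trimmedSup
  rw [lintegral_iSup_directed (f := fun (i : {i // ∫⁻ x, partialCap S P i 0 μ x
      ∂(μ.toMeasure : Measure X) < 2}) x => (partialCap S P i 0 μ x : ℝ≥0∞))
    (fun i => (h_meas i).aemeasurable) (h_mono.comp (Subtype.mono_coe _)).directed_le]
  exact iSup_le fun i => i.2.le

theorem stepValue_le_trimmedSup {P : ℕ → Prop} (hi : i ∈ trimmed S P μ)
    (hx : dist x (S.ideal (stepCenter (atomStep i))) < stepRadius (atomStep i)) :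
    (stepValue (atomStep i) : ℝ≥0∞) ≤ trimmedSup S P μ x :=
  le_iSup_of_le ⟨i, hi.2.2⟩ <| Nat.cast_le.2 <|
    stepValue_le_partialCap le_rfl hi.1 (atomGap_nonpos_iff.2 ⟨hi.2.1.le, hx.le⟩)

theorem universalTest_le (P : ℕ → ℕ → Prop) (μ : LevyProkhorov (ProbabilityMeasure X)) (x : X) :
    universalTest S P μ x ≤ 2⁻¹ + ∑' c, (2⁻¹ : ℝ≥0∞) ^ (c + 3) * trimmedSup S (P c) μ x := by
  rw [universalTest_apply]
  refine iSup₂_le ?_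
  rintro n (hn | ⟨c, i, hi, rfl⟩)
  · have h_value : (nnRatNum n.unpair.2 : ℝ≥0∞) = 2⁻¹ := by
      have hn : n.unpair.2 = Nat.pair 1 1 := hn
      rw [nnRatNum_unpair_snd, stepValue, stepValueDen, hn, Nat.unpair_pair]
      simp [one_add_one_eq_two]
    rw [stepFun_apply, h_value]
    exact le_add_right (ite_le_sup _ _ _ |>.trans (by simp))
  · refine le_add_left (le_trans ?_ (ENNReal.le_tsum c))
    rw [stepFun_scaleStep]
    split_ifs with hx
    · gcongr
      exact stepValue_le_trimmedSup hi hx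
    · exact zero_le

theorem lintegral_universalTest_le_one (P : ℕ → ℕ → Prop)
    (μ : LevyProkhorov (ProbabilityMeasure X)) :
    ∫⁻ x, universalTest S P μ x ∂(μ.toMeasure : Measure X) ≤ 1 := by
  calc ∫⁻ x, universalTest S P μ x ∂(μ.toMeasure : Measure X)
      ≤ ∫⁻ x, (2⁻¹ + ∑' c, (2⁻¹ : ℝ≥0∞) ^ (c + 3) * trimmedSup S (P c) μ x)
          ∂(μ.toMeasure : Measure X) := lintegral_mono (universalTest_le P μ)
    _ = 2⁻¹ + ∑' c, (2⁻¹ : ℝ≥0∞) ^ (c + 3) *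
          ∫⁻ x, trimmedSup S (P c) μ x ∂(μ.toMeasure : Measure X) := by
        rw [lintegral_add_left measurable_const, lintegral_const, measure_univ, mul_one,
          lintegral_tsum fun c => ((measurable_trimmedSup (P c) μ).const_mul _).aemeasurable]
        simp only [lintegral_const_mul _ (measurable_trimmedSup (P _) μ)]
    _ ≤ 2⁻¹ + ∑' c : ℕ, (2⁻¹ : ℝ≥0∞) ^ (c + 3) * 2 := by
        gcongr with c
        exact lintegral_trimmedSup_le_two (P c) μ
    _ = 2⁻¹ + ∑' c : ℕ, (2⁻¹ : ℝ≥0∞) ^ (c + 1) * 2⁻¹ := by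
        congr! 3 with c
        rw [pow_succ, pow_succ, mul_assoc, ENNReal.inv_mul_cancel two_ne_zero ENNReal.ofNat_ne_top,
          mul_one]
    _ = 1 := by
        rw [ENNReal.tsum_mul_right, ENNReal.tsum_geometric_add_one, ENNReal.one_sub_inv_two,
          inv_inv, ENNReal.inv_mul_cancel two_ne_zero ENNReal.ofNat_ne_top, one_mul,
          ENNReal.inv_two_add_inv_two]

end Integral

section Universality

variable {X : Type*} [MetricSpace X] [CompleteSpace X] [MeasurableSpace X] [BorelSpace X]
  {S : ComputableMetricSpace X}
  {T : LevyProkhorov (ProbabilityMeasure X) → LowerFun S ennrealLattice}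
  {μ : LevyProkhorov (ProbabilityMeasure X)} {x : X} {c b l m n : ℕ}

variable (S) in
/-- On every name of every measure `μ`, the partial recursive function with code `c` lists codes of
step functions with supremum `T μ`. The empty prefix is left out, so that each prefix has a last
term. -/
def Computes (c : ℕ) (T : LevyProkhorov (ProbabilityMeasure X) → LowerFun S ennrealLattice) :
    Prop :=
  ∀ μ σ, IsCauchyName (idealMeasure S) σ μ → ∀ x,
    T μ x = ⨆ n ∈ {n | ∃ k, Lists c ((List.range (k + 1)).map σ) n},
      stepFun S ennrealLattice n x

theorem exists_computes (hT : IsConstructive (idealMeasure S)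
    (LowerFun.enumerativeLattice S ennrealLattice) T) : ∃ c, Computes S c T := by
  obtain ⟨F, hF, h_describes⟩ := hT
  obtain ⟨c, hc⟩ := exists_lists_iff hF.computable
  refine ⟨c, fun μ σ hσ x => ?_⟩
  have h_output : operatorOutput F σ =
      {n | ∃ k, Lists c ((List.range (k + 1)).map σ) n} := by
    ext n
    simp only [operatorOutput, hc, Set.mem_ofPred_eq]
    constructor
    · rintro ⟨k, hn⟩
      have h_prefix : (List.range k).map σ <+: (List.range (k + 1)).map σ := by
        rw [List.range_succ, List.map_append]
        exact List.prefix_append _ _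
      exact ⟨k, (hF.monotone _ _ h_prefix).subset hn⟩
    · rintro ⟨k, hn⟩
      exact ⟨k + 1, hn⟩
  rw [← h_output]
  exact (describes_iff S _ _).1 (h_describes μ σ hσ) x

theorem Produces.stepValue_le (h : Produces S c b l m) (hT : Computes S c T)
    (hμ : dist (idealMeasure S b) μ ≤ (1 / 2) ^ l)
    (hx : dist x (S.ideal (stepCenter m)) ≤ stepRadius m) : (stepValue m : ℝ≥0∞) ≤ T μ x := by
  obtain ⟨u, n, rfl, hu, hn, hmn⟩ := h
  have hb : dist (idealMeasure S b) μ < (1 / 2 : ℝ) ^ u.length :=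
    hμ.trans_lt <| pow_lt_pow_right_of_lt_one₀ (by norm_num) (by norm_num) (Nat.lt_succ_self _)
  obtain ⟨σ, hσ, hσu⟩ := hu.exists_isCauchyName (denseRange_idealMeasure S) hb
  rw [hT μ σ hσ]
  refine le_iSup₂_of_le n ⟨u.length, by rwa [hσu]⟩ ?_
  rw [stepFun_apply, if_pos (hmn.1 ▸ hx.trans_lt hmn.stepRadius_lt)]
  exact hmn.stepValue_le

theorem Lists.exists_produces {σ : ℕ → ℕ} {k : ℕ} (h : Lists c ((List.range (k + 1)).map σ) n)
    (hσ : IsCauchyName (idealMeasure S) σ μ)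
    (hx : dist x (S.ideal (stepCenter n)) < stepRadius n) :
    ∃ m, Produces S c (σ k) (k + 1) m ∧ dist x (S.ideal (stepCenter m)) < stepRadius m ∧
      (nnRatNum n.unpair.2 : ℝ≥0∞) ≤ stepValue m + 1 := by
  obtain ⟨m, hmn, hxm, h_value⟩ := exists_stepRefines dist_nonneg hx
  have h_append : (List.range (k + 1)).map σ = (List.range k).map σ ++ [σ k] := by
    rw [List.range_succ, List.map_append, List.map_singleton]
  have h_prefix := hσ.isNamePrefix (k + 1)
  rw [h_append] at h h_prefix
  exact ⟨m, ⟨_, n, by simp, h_prefix, h, hmn⟩, hmn.1 ▸ hxm, h_value⟩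

theorem partialCap_le_of_forall {P : ℕ → Prop} {i : ℕ} {δ : ℝ} {t : ℝ≥0∞}
    (h : ∀ j, P j → atomGap S j μ x ≤ δ → (stepValue (atomStep j) : ℝ≥0∞) ≤ t) :
    (partialCap S P i δ μ x : ℝ≥0∞) ≤ t := by
  induction t with
  | top => exact le_top
  | coe t =>
    have h_floor : partialCap S P i δ μ x ≤ ⌊t⌋₊ :=
      partialCap_le_iff.2 fun j _ hPj hj => Nat.le_floor (by exact_mod_cast h j hPj hj)
    exact_mod_cast (Nat.cast_le.2 h_floor).trans (Nat.floor_le zero_le)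

variable {P : ℕ → ℕ → Prop}

theorem partialCap_le_of_computes (hP : IsAtomEnumeration S P) (hT : Computes S c T) (i : ℕ) :
    (partialCap S (P c) i 0 μ x : ℝ≥0∞) ≤ T μ x :=
  partialCap_le_of_forall fun j hj h_gap =>
    have ⟨hμ, hx⟩ := atomGap_nonpos_iff.1 h_gap
    ((hP _ _ _ _).2 ⟨j, hj, rfl, rfl, rfl⟩).stepValue_le hT hμ hx

theorem mem_trimmed_of_computes (hP : IsAtomEnumeration S P) (hT : Computes S c T)
    (h_int : ∫⁻ x, T μ x ∂(μ.toMeasure : Measure X) ≤ 1) {i : ℕ} (hi : P c i)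
    (hμ : dist (idealMeasure S (atomMeasure i)) μ < (1 / 2) ^ atomExponent i) :
    i ∈ trimmed S (P c) μ :=
  ⟨hi, hμ, calc
    ∫⁻ x, partialCap S (P c) i 0 μ x ∂(μ.toMeasure : Measure X)
      ≤ ∫⁻ x, T μ x ∂(μ.toMeasure : Measure X) :=
        lintegral_mono fun _ => partialCap_le_of_computes hP hT i
    _ ≤ 1 := h_int
    _ < 2 := ENNReal.one_lt_two⟩

theorem mul_nnRatNum_le_universalTest (hP : IsAtomEnumeration S P) (hT : Computes S c T)
    (h_int : ∫⁻ x, T μ x ∂(μ.toMeasure : Measure X) ≤ 1) {τ : ℕ → ℕ}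
    (hτ : ∀ k, dist (idealMeasure S (τ k)) μ < (1 / 2) ^ (k + 1)) {k : ℕ}
    (hn : Lists c ((List.range (k + 1)).map τ) n)
    (hx : dist x (S.ideal (stepCenter n)) < stepRadius n) :
    2⁻¹ ^ (c + 4) * (nnRatNum n.unpair.2 : ℝ≥0∞) ≤ universalTest S P μ x := by
  obtain ⟨m, hm, hxm, h_value⟩ := hn.exists_produces (isCauchyName_of_dist_lt hτ) hx
  obtain ⟨i, hi, h_measure, h_exponent, rfl⟩ := (hP _ _ _ _).1 hm
  have h_mem : i ∈ trimmed S (P c) μ :=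
    mem_trimmed_of_computes hP hT h_int hi (by rw [h_measure, h_exponent]; exact hτ k)
  have h_atom := mul_stepValue_le_universalTest h_mem hxm
  have h_const : (2⁻¹ : ℝ≥0∞) ^ (c + 3) ≤ universalTest S P μ x :=
    (pow_le_of_le_one (by simp) (by simp) (Nat.succ_ne_zero _)).trans half_le_universalTest
  calc 2⁻¹ ^ (c + 4) * (nnRatNum n.unpair.2 : ℝ≥0∞)
      ≤ 2⁻¹ ^ (c + 4) * (stepValue (atomStep i) + 1) := by gcongr
    _ = 2⁻¹ * (2⁻¹ ^ (c + 3) * stepValue (atomStep i)) + 2⁻¹ * 2⁻¹ ^ (c + 3) := by ring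
    _ ≤ 2⁻¹ * universalTest S P μ x + 2⁻¹ * universalTest S P μ x := by gcongr
    _ = universalTest S P μ x := by rw [← add_mul, ENNReal.inv_two_add_inv_two, one_mul]

theorem exists_mul_le_universalTest (hP : IsAtomEnumeration S P) (hT : IsUniformTest S T) :
    ∃ r : ℝ≥0, 0 < r ∧ ∀ μ x, (r : ℝ≥0∞) * T μ x ≤ universalTest S P μ x := by
  obtain ⟨c, hc⟩ := exists_computes hT.constructive
  refine ⟨2⁻¹ ^ (c + 4), by positivity, fun μ x => ?_⟩
  obtain ⟨τ, hτ⟩ := exists_forall_dist_lt (denseRange_idealMeasure S) μ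
    (r := fun k => (1 / 2) ^ (k + 1)) fun k => by positivity
  simp only [hc μ τ (isCauchyName_of_dist_lt hτ), ENNReal.mul_iSup, iSup_le_iff]
  rintro n ⟨k, hn⟩
  rw [stepFun_apply]
  split_ifs with hx
  · have h_coe : ((2⁻¹ ^ (c + 4) : ℝ≥0) : ℝ≥0∞) = 2⁻¹ ^ (c + 4) := by
      rw [ENNReal.coe_pow, ENNReal.coe_inv two_ne_zero, ENNReal.coe_ofNat]
    rw [h_coe]
    exact mul_nnRatNum_le_universalTest hP hc (hT.lintegral_le_one μ) hτ hn hx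
  · rw [mul_zero]
    exact zero_le

end Universality

end CompMetric

theorem mainTheorem2 {X : Type*} [MetricSpace X] [CompleteSpace X] [MeasurableSpace X]
    [BorelSpace X] (S : CompMetric.ComputableMetricSpace X) :
    ∃ Tu : LevyProkhorov (ProbabilityMeasure X) →
        CompMetric.LowerFun S CompMetric.ennrealLattice,
      CompMetric.IsUniformTest S Tu ∧
      ∀ T : LevyProkhorov (ProbabilityMeasure X) →
          CompMetric.LowerFun S CompMetric.ennrealLattice,
        CompMetric.IsUniformTest S T →
        ∃ c : ℝ≥0, 0 < c ∧ ∀ μ x, (c : ℝ≥0∞) * T μ x ≤ Tu μ x := by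
  obtain ⟨P, hP, hP_atoms⟩ := CompMetric.exists_isAtomEnumeration S
  exact ⟨CompMetric.universalTest S P, ⟨CompMetric.isConstructive_universalTest hP,
    CompMetric.lintegral_universalTest_le_one P⟩,
    fun T hT => CompMetric.exists_mul_le_universalTest hP_atoms hT⟩
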